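/- **Setting.** A server and $N\ge1$ agents interact over $T\ge1$ steps. At step $t\in[T]$ the agents in a (deterministic) set $\mathcal N_0^t$ are uncorrupted; let $\mathcal N_1=\bigcup_{t}(\mathcal N_0^t)^c$ be the set of agents that are ever corrupted, $\alpha=|\mathcal N_1|/N$, assume $\alpha<1/2$, and put $C_\alpha=\frac{2-2\alpha}{1-2\alpha}$. Each $i\in\mathcal N_0^t$ receives a nonempty compact decision set $\mathcal D_i^t\subseteq\{x\in\mathbb R^d:\|x\|_2\le1\}$, plays $x_i^t\in\mathcal D_i^t$ and gets the reward $r_i^t=\langle x_i^t,\theta^*\rangle+\eta_i^t$, where $\|\theta^*\|_2\le\sqrt d$, $d\ge 1$. Conditionally on the history before step $t$, the pairs $(\mathcal D_i^t,\eta_i^t)$, $i\in\mathcal N_0^t$, are i.i.d. with a law under which $\mathcal D_i^t$ and $\eta_i^t$ are independent and $\eta_i^t$ is $R$-sub-Gaussian ($R\ge0$). The history contains everything known to the agents and to the attacker. The robust regret is $$R_T=\sum_{t=1}^T\sum_{i\in\mathcal N_0^t}\Big(\max_{x\in\mathcal D_i^t}\langle x,\theta^*\rangle-\langle x_i^t,\theta^*\rangle\Big).$$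 **Algorithm (Byzantine-UCB).** The steps are divided into consecutive episodes $\mathcal T_1,\dots,\mathcal T_K$ of length $L\ge1$, $K=\lceil T/L\rceil$ (the last one may be incomplete). At the start of episode $k$ the server computes $\Lambda_k=\mathrm{GM}_{i}(V_i^k)+\lambda_kI$, $b_k=\mathrm{GM}_i(v_i^k)$, $\theta_k=\Lambda_k^{-1}b_k$ and broadcasts $\theta_k,\Lambda_k$; here $\mathrm{GM}_i(z_i)$ is an exact geometric median, i.e. a minimiser of $z\mapsto\frac1N\sum_{i=1}^N\|z-z_i\|$ (Euclidean norm for vectors, Frobenius norm for matrices). At $t\in\mathcal T_k$ each $i\in\mathcal N_0^t$ plays $x_i^t\in\arg\max_{x\in\mathcal D_i^t}\langle x,\theta_k\rangle+\beta_k\|x\|_{\Lambda_k^{-1}}$, where $\|x\|_A=\sqrt{x^\top Ax}$ and ties are broken by a measurable rule common to all agents. At the end of episode $k$ every agent sends a pair $(U_i^k,u_i^k)$. It equals $\big(\sum_{t\in\mathcal T_k}x_i^t(x_i^t)^\top,\sum_{t\in\mathcal T_k}x_i^tr_i^t\big)$ if agent $i$ was uncorrupted throughout $\mathcal T_k$,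 and is otherwise an arbitrary matrix and vector, possibly depending on everything that has happened so far. The server replaces the pair by $(0,0)$ if $U_i^k$ is not symmetric, and then sets $V_i^{k+1}=V_i^k+U_i^k$, $v_i^{k+1}=v_i^k+u_i^k$, starting from $V_i^1=0$, $v_i^1=0$. Let $\sigma\ge0$ be such that almost surely $\|x_i^t(x_i^t)^\top-\mathbb E[x_i^t(x_i^t)^\top]\|_F^2\le\sigma^2$ for all $t\in[T]$ and $i\in\mathcal N_0^t$, where the expectation is over $\mathcal D_i^t$, conditionally on the history before step $t$. **Theorem.** There is an absolute constant $c>0$ such that the following holds in this setting. For $\delta\in(0,1)$ let $\iota=\log(128NT/\delta)$, and run the algorithm with $$\lambda_k=\max\{L,\;8\sqrt{L\iota}\,C_\alpha\sigma\sqrt k\},\qquad \beta_k=3\sqrt{\lambda_kd}+\frac{4\sqrt{(k-1)Ld\iota}\,C_\alpha(\sigma+R)}{\sqrt{\lambda_k}}+2R\sqrt{\frac{d\iota}{N}} .$$ Then, with probability at least $1-\delta$, $$R_T\le c\left(Rd\iota\sqrt{NT}+Nd\sqrt{T\iota}\left(\sqrt{L+C_\alpha\sigma\sqrt{T\iota}}+\frac{\sqrt{T\iota}\,C_\alpha(\sigma+R)}{\sqrt{L+C_\alpha\sigma\sqrt{T\iota}}}\right)\right).$$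 In particular, if $L\ge1$ is $C_\alpha(\sigma+R)\sqrt{T\iota}$ up to rounding (that is, differs from it by at most $1$), then, with probability at least $1-\delta$, $$R_T\le c\,\big(1+R+\sqrt{C_\alpha(\sigma+R)}\big)\,\iota\; dN\,T^{3/4},$$ i.e. $R_T=\tilde{\mathcal O}(dNT^{3/4})$, and, if $\sigma+R>0$, the number $K$ of communication rounds satisfies $K\le c\big(1+\frac1{C_\alpha(\sigma+R)}\big)\sqrt T$, i.e. $K=\mathcal O(\sqrt T)$. -/

import Mathlib

open MeasureTheory ProbabilityTheory TopologicalSpace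
open scoped Matrix Matrix.Norms.Frobenius

namespace ByzantineUCB

/-- Vectors of `ℝ^d` with the Euclidean norm. -/
abbrev Vec (d : ℕ) := EuclideanSpace ℝ (Fin d)

/-- Real `d × d` matrices; the norm in force is the Frobenius norm. -/
abbrev Mat (d : ℕ) := Matrix (Fin d) (Fin d) ℝ

/-- Decision sets: nonempty compact subsets of `ℝ^d`, with the Hausdorff distance. -/
abbrev DecisionSet (d : ℕ) := NonemptyCompacts (Vec d)

instance instMeasurableSpaceDecisionSet (d : ℕ) : MeasurableSpace (DecisionSet d) :=
  borel (DecisionSet d)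

instance instBorelSpaceDecisionSet (d : ℕ) : BorelSpace (DecisionSet d) := ⟨rfl⟩

/-- Entrywise (product) measurable structure on matrices. -/
instance instMeasurableSpaceMat (d : ℕ) : MeasurableSpace (Mat d) :=
  inferInstanceAs (MeasurableSpace (Fin d → Fin d → ℝ))

/-- `m` is an exact geometric median of the family `z`: it minimises the average distance
to the points `z i`. -/
def IsGeometricMedian {V : Type*} [SeminormedAddCommGroup V] {N : ℕ} (z : Fin N → V) (m : V) :
    Prop :=
  ∀ y : V, (1 / (N : ℝ)) * ∑ i, ‖m - z i‖ ≤ (1 / (N : ℝ)) * ∑ i, ‖y - z i‖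

/-- The outer product `x xᵀ`. -/
def outer {d : ℕ} (x : Vec d) : Mat d := Matrix.vecMulVec x.ofLp x.ofLp

/-- The weighted norm `‖x‖_A = √(xᵀ A x)`. -/
noncomputable def wnorm {d : ℕ} (A : Mat d) (x : Vec d) : ℝ := √(x.ofLp ⬝ᵥ (A *ᵥ x.ofLp))

/-! ### The environment

Time steps are counted from `0`: step `t < T` here is the `(t+1)`-st step. -/

/-- A federated linear bandit with `N` agents over `ℝ^d` on a sample space `Ω`. -/
structure Env (Ω : Type*) (d N : ℕ) where
  /-- the set of agents that are not corrupted at step `t` -/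
  reliable : ℕ → Finset (Fin N)
  /-- the unknown parameter -/
  θstar : Vec d
  /-- the decision set presented to agent `i` at step `t` -/
  D : ℕ → Fin N → Ω → DecisionSet d
  /-- the reward noise of agent `i` at step `t` -/
  η : ℕ → Fin N → Ω → ℝ
  /-- the law of (decision set, noise) at step `t`, given the history before step `t` -/
  law : ℕ → Ω → Measure (DecisionSet d × ℝ)

namespace Env

variable {Ω : Type*} {d N : ℕ}

/-- The agents corrupted at some step before `T`. -/
def corrupted (e : Env Ω d N) (T : ℕ) : Finset (Fin N) :=
  (Finset.range T).biUnion fun t => (e.reliable t)ᶜ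

/-- The fraction `α` of agents that are ever corrupted. -/
noncomputable def alpha (e : Env Ω d N) (T : ℕ) : ℝ := ((e.corrupted T).card : ℝ) / N

/-- The constant `C_α = (2 - 2α) / (1 - 2α)`. -/
noncomputable def Calpha (e : Env Ω d N) (T : ℕ) : ℝ :=
  (2 - 2 * e.alpha T) / (1 - 2 * e.alpha T)

/-- The standing assumptions on the environment up to the horizon `T`, with `R`-sub-Gaussian noise.
`ℱ t` is the history (everything known to the agents and to the attacker) before step `t`. -/
structure Valid [mΩ : MeasurableSpace Ω] (e : Env Ω d N) (μ : Measure Ω)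
    (ℱ : Filtration ℕ mΩ) (T : ℕ) (R : ℝ) : Prop where
  norm_θstar_le : ‖e.θstar‖ ≤ √(d : ℝ)
  norm_le_one : ∀ t < T, ∀ i ∈ e.reliable t, ∀ ω, ∀ x ∈ e.D t i ω, ‖x‖ ≤ 1
  measurable_D : ∀ t < T, ∀ i ∈ e.reliable t, Measurable[ℱ (t + 1)] (e.D t i)
  measurable_η : ∀ t < T, ∀ i ∈ e.reliable t, Measurable[ℱ (t + 1)] (e.η t i)
  measurable_law : ∀ t < T, Measurable[ℱ t] (e.law t)
  prob_law : ∀ t < T, ∀ ω, IsProbabilityMeasure (e.law t ω)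
  /-- given the history before step `t`, the pairs (decision set, noise) of the uncorrupted agents
  are independent with common law `law t` -/
  condIID : ∀ t < T, ∀ A : Set Ω, MeasurableSet[ℱ t] A →
    ∀ B : Fin N → Set (DecisionSet d × ℝ), (∀ i, MeasurableSet (B i)) →
      μ (A ∩ ⋂ i ∈ e.reliable t, {ω | (e.D t i ω, e.η t i ω) ∈ B i})
        = ∫⁻ ω in A, ∏ i ∈ e.reliable t, e.law t ω (B i) ∂μ
  /-- decision set and noise are independent -/
  indep : ∀ t < T, ∀ ω, e.law t ω = ((e.law t ω).map Prod.fst).prod ((e.law t ω).map Prod.snd)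
  /-- the noise is `R`-sub-Gaussian -/
  subGaussian : ∀ t < T, ∀ ω,
    HasSubgaussianMGF id ⟨R ^ 2, sq_nonneg R⟩ ((e.law t ω).map Prod.snd)

end Env

/-! ### Parameters of the algorithm -/

/-- `ι = log (128 N T / δ)`. -/
noncomputable def iota (N T : ℕ) (δ : ℝ) : ℝ := Real.log (128 * N * T / δ)

/-- Regularisation of the episode with index `k`, counted from `0` (the `(k+1)`-st episode):
`max {L, 8 √(L ι) C σ √(k+1)}`. -/
noncomputable def reg (L : ℕ) (ι C σ : ℝ) (k : ℕ) : ℝ :=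
  max (L : ℝ) (8 * √(L * ι) * C * σ * √((k : ℝ) + 1))

/-- Confidence level of the episode with index `k`, counted from `0` (the `(k+1)`-st episode). -/
noncomputable def conf (d N L : ℕ) (ι C σ R : ℝ) (k : ℕ) : ℝ :=
  3 * √(reg L ι C σ k * d)
    + 4 * √((k : ℝ) * L * d * ι) * C * (σ + R) / √(reg L ι C σ k)
    + 2 * R * √(d * ι / N)

/-- The synchronisation steps before the horizon `T`: every `L`-th step. Episode `k` consists of
the steps `t` with `k L ≤ t < (k+1) L`, `t < T`; the last one may be incomplete. -/
def syncSteps (T L : ℕ) : Finset ℕ := (Finset.range T).filter (fun t => L ∣ t)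

/-- The optimistic index `⟨x, θ⟩ + β ‖x‖_{Λ⁻¹}` of an action `x`. -/
noncomputable def ucb {d : ℕ} (β : ℝ) (θ : Vec d) (Λ : Mat d) (x : Vec d) : ℝ :=
  inner ℝ x θ + β * wnorm Λ⁻¹ x

/-- `pick t θ Λ D` is a measurable choice of a maximiser over `D` of the optimistic index with
the confidence level `β t`. The rule (hence the breaking of ties) is shared by all agents. -/
structure IsArgmaxRule {d : ℕ} (β : ℕ → ℝ)
    (pick : ℕ → Vec d → Mat d → DecisionSet d → Vec d) : Prop where
  mem : ∀ t θ Λ D, pick t θ Λ D ∈ D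
  max : ∀ t θ Λ D, ∀ x ∈ D, ucb (β t) θ Λ x ≤ ucb (β t) θ Λ (pick t θ Λ D)
  meas : ∀ t, Measurable fun p : Vec d × Mat d × DecisionSet d => pick t p.1 p.2.1 p.2.2

/-! ### Executions of the algorithm -/

/-- The record of an execution. Episodes are counted from `0`. -/
structure Run (Ω : Type*) (d N : ℕ) where
  /-- the action of agent `i` at step `t` -/
  x : ℕ → Fin N → Ω → Vec d
  /-- the Gram matrix that agent `i` sends at the end of episode `k` -/
  msgU : ℕ → Fin N → Ω → Mat d
  /-- the weighted feature sum that agent `i` sends at the end of episode `k` -/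
  msgu : ℕ → Fin N → Ω → Vec d
  /-- the aggregate of the accumulated Gram matrices at the start of episode `k` -/
  G : ℕ → Ω → Mat d
  /-- the aggregate of the accumulated feature sums at the start of episode `k` -/
  b : ℕ → Ω → Vec d

namespace Run

variable {Ω : Type*} {d N : ℕ}

open Classical in
/-- The Gram matrix after the controller's check: replaced by `0` if not symmetric. -/
noncomputable def checkedU (r : Run Ω d N) (k : ℕ) (i : Fin N) (ω : Ω) : Mat d :=
  if (r.msgU k i ω).IsSymm then r.msgU k i ω else 0

open Classical in
/-- The feature sum after the check: replaced by `0` if the Gram matrix is not symmetric. -/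
noncomputable def checkedu (r : Run Ω d N) (k : ℕ) (i : Fin N) (ω : Ω) : Vec d :=
  if (r.msgU k i ω).IsSymm then r.msgu k i ω else 0

/-- The accumulated Gram matrix of agent `i` at the start of episode `k`. -/
noncomputable def V (r : Run Ω d N) (k : ℕ) (i : Fin N) (ω : Ω) : Mat d :=
  ∑ j ∈ Finset.range k, r.checkedU j i ω

/-- The accumulated feature sum of agent `i` at the start of episode `k`. -/
noncomputable def v (r : Run Ω d N) (k : ℕ) (i : Fin N) (ω : Ω) : Vec d :=
  ∑ j ∈ Finset.range k, r.checkedu j i ω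

/-- `Λ_k`: the aggregate plus the regularisation `lam k` times the identity. -/
noncomputable def Λ (r : Run Ω d N) (lam : ℕ → ℝ) (k : ℕ) (ω : Ω) : Mat d :=
  r.G k ω + lam k • (1 : Mat d)

/-- `θ_k = Λ_k⁻¹ b_k`. -/
noncomputable def θ (r : Run Ω d N) (lam : ℕ → ℝ) (k : ℕ) (ω : Ω) : Vec d :=
  WithLp.toLp 2 ((r.Λ lam k ω)⁻¹ *ᵥ (r.b k ω).ofLp)

/-- The reward `⟨x, θ*⟩ + η` of agent `i` at step `t`. -/
noncomputable def reward (r : Run Ω d N) (e : Env Ω d N) (t : ℕ) (i : Fin N) (ω : Ω) : ℝ :=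
  inner ℝ (r.x t i ω) e.θstar + e.η t i ω

/-- `r` is an execution of the algorithm with exact geometric-median aggregation, episodes of
length `L`, regularisation `lam` and selection rule `pick`, in the environment `e` up to the
horizon `T`. An agent corrupted at some step of an episode sends an arbitrary message at the end
of this episode, which may depend on all that has happened so far. -/
structure IsExecution [mΩ : MeasurableSpace Ω] (r : Run Ω d N) (e : Env Ω d N)
    (ℱ : Filtration ℕ mΩ) (T L : ℕ) (lam : ℕ → ℝ)
    (pick : ℕ → Vec d → Mat d → DecisionSet d → Vec d) : Prop where
  /-- the aggregates are geometric medians (Frobenius norm for the matrices) -/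
  median_G : ∀ k, k * L < T → ∀ ω, IsGeometricMedian (fun i => r.V k i ω) (r.G k ω)
  median_b : ∀ k, k * L < T → ∀ ω, IsGeometricMedian (fun i => r.v k i ω) (r.b k ω)
  measurable_G : ∀ k, k * L < T → Measurable[ℱ (k * L)] (r.G k)
  measurable_b : ∀ k, k * L < T → Measurable[ℱ (k * L)] (r.b k)
  /-- uncorrupted agents play the optimistic action -/
  action : ∀ t < T, ∀ i ∈ e.reliable t, ∀ ω,
    r.x t i ω = pick t (r.θ lam (t / L) ω) (r.Λ lam (t / L) ω) (e.D t i ω)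
  /-- agents uncorrupted throughout an episode send the true statistics -/
  honest_U : ∀ k, (k + 1) * L ≤ T → ∀ i,
    (∀ t ∈ Finset.Ico (k * L) ((k + 1) * L), i ∈ e.reliable t) → ∀ ω,
      r.msgU k i ω = ∑ t ∈ Finset.Ico (k * L) ((k + 1) * L), outer (r.x t i ω)
  honest_u : ∀ k, (k + 1) * L ≤ T → ∀ i,
    (∀ t ∈ Finset.Ico (k * L) ((k + 1) * L), i ∈ e.reliable t) → ∀ ω,
      r.msgu k i ω
        = ∑ t ∈ Finset.Ico (k * L) ((k + 1) * L), r.reward e t i ω • r.x t i ω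
  /-- no message depends on the future -/
  measurable_msgU : ∀ k, (k + 1) * L ≤ T → ∀ i, Measurable[ℱ ((k + 1) * L)] (r.msgU k i)
  measurable_msgu : ∀ k, (k + 1) * L ≤ T → ∀ i, Measurable[ℱ ((k + 1) * L)] (r.msgu k i)

/-- Almost surely `‖x xᵀ - E[x xᵀ]‖_F² ≤ σ²` for every action `x` of an uncorrupted agent, the
expectation being over its decision set at this step, i.e. conditional on the history. -/
def VarianceBound [mΩ : MeasurableSpace Ω] (r : Run Ω d N) (e : Env Ω d N) (μ : Measure Ω)
    (ℱ : Filtration ℕ mΩ) (T : ℕ) (σ : ℝ) : Prop :=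
  ∀ t < T, ∀ i ∈ e.reliable t, ∀ᵐ ω ∂μ,
    ‖outer (r.x t i ω) - Matrix.of fun a c =>
      (μ[fun ω' => outer (r.x t i ω') a c | ℱ t]) ω‖ ^ 2 ≤ σ ^ 2

/-- The robust (pseudo-)regret: only uncorrupted agent-steps count. -/
noncomputable def regret (r : Run Ω d N) (e : Env Ω d N) (T : ℕ) (ω : Ω) : ℝ :=
  ∑ t ∈ Finset.range T, ∑ i ∈ e.reliable t,
    (sSup ((fun y : Vec d => (inner ℝ y e.θstar : ℝ)) '' (e.D t i ω : Set (Vec d)))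
      - inner ℝ (r.x t i ω) e.θstar)

end Run

/-- The expression
`R d ι √(NT) + N d √(Tι) (√(L + C σ √(Tι)) + √(Tι) C (σ+R) / √(L + C σ √(Tι)))`. -/
noncomputable def regretRate (d N T L : ℕ) (ι C σ R : ℝ) : ℝ :=
  R * d * ι * √(N * T)
    + N * d * √(T * ι) *
      (√(L + C * σ * √(T * ι)) + √(T * ι) * C * (σ + R) / √(L + C * σ * √(T * ι)))

end ByzantineUCB

namespace ByzantineUCB

/-! ### Dimension-free tail bounds in Hilbert spaces -/

/-! All uncorrupted agents apply the same policy to decision sets with the same conditional law, so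
at each step `s` their outer products share one conditional mean `M s`. Let `H` be the sum of these
means up to the start of episode `k`. The proof compares everything with `H`.

Concentration: for a sum `S` with conditionally centred increments bounded by `c`, `E cosh(l‖S‖)`
grows by a factor of at most `exp(l²c²/2)` per step. This gives dimension-free tails for the Gram
deviations in Frobenius norm; a sub-Gaussian variant handles the noise sums. A union bound over
agents and episode starts yields the event `Concentrated`.

Robustness: if all but a fraction `α < 1/2` of the points lie within `ρ` of a centre, their
geometric median lies within `C_α ρ` of it (`IsGeometricMedian.norm_sub_le`). Hence the aggregate
`G` is close to `H` and `b` is close to `H θ*`. The regularisation is chosen so that `‖G - H‖ ≤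
λ/4`, which makes `Λ` positive definite and gives a confidence ellipsoid
(`abs_inner_sub_le_of_confidence`).

Regret: optimism bounds the loss of one action by `2β‖x‖_{Λ⁻¹}`. The sum over steps is controlled
agent by agent: by concentration in the opposite direction, `H` dominates each agent's own Gram
matrix up to an error of `λ/4`, and `λ ≥ L` absorbs the steps of the running episode. So `Λ`
dominates a quarter of the agent's up-to-date regularised Gram matrix (`Run.IsExecution.form_le`).
The elliptical potential lemma and Cauchy–Schwarz then give a factor of order `√(T d ι)` per agent.
What remains is to bound `β` uniformly in `k` and to compute the rate. -/

theorem convexOn_cosh_sqrt : ConvexOn ℝ (Set.Ici 0) fun q : ℝ => Real.cosh √q := by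
  -- As a power series in `q` the function has nonnegative coefficients, so convexity is inherited
  -- term by term.
  have hs : ∀ q : ℝ, 0 ≤ q → HasSum (fun n : ℕ => q ^ n / ((2 * n).factorial : ℝ))
      (Real.cosh √q) := fun q hq => by
    have h := Real.hasSum_cosh √q
    simpa only [pow_mul, Real.sq_sqrt hq] using h
  refine ⟨convex_Ici 0, fun x hx y hy a b ha hb hab => ?_⟩
  have hx' : (0 : ℝ) ≤ x := hx
  have hy' : (0 : ℝ) ≤ y := hy
  have hxy : 0 ≤ a • x + b • y := by simp only [smul_eq_mul]; positivity
  refine hasSum_le (fun n => ?_) (hs _ hxy)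
    (((hs x hx').mul_left a).add ((hs y hy').mul_left b))
  have h := (convexOn_pow n).2 hx hy ha hb hab
  simp only [smul_eq_mul] at h ⊢
  rw [← mul_div_assoc, ← mul_div_assoc, ← add_div]
  gcongr

/-- With `w = ⟨s,x⟩/‖s‖`, the square `‖s + t x‖²` is at most the average of `(‖s‖ ± t)²` with
weights `(1 ± w)/2`; convexity and monotonicity of `cosh √·` transfer this to `cosh`. The gain is
that the bound is affine in `⟨s,x⟩`, hence easy to integrate. For `s = 0` division by zero gives `w
= 0`, as it should. -/
theorem cosh_norm_add_smul_le {E : Type*} [NormedAddCommGroup E] [InnerProductSpace ℝ E]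
    (s x : E) (hx : ‖x‖ ≤ 1) (t : ℝ) :
    Real.cosh ‖s + t • x‖ ≤ (1 + inner ℝ s x / ‖s‖) / 2 * Real.cosh (‖s‖ + t)
      + (1 - inner ℝ s x / ‖s‖) / 2 * Real.cosh (‖s‖ - t) := by
  set w := inner ℝ s x / ‖s‖ with hw
  have hsx : inner ℝ s x = w * ‖s‖ := by
    rcases eq_or_ne s 0 with rfl | h
    · simp
    · rw [hw, div_mul_cancel₀]; simpa using h
  have habs : |w| ≤ 1 := by
    rw [hw, abs_div, abs_norm]
    refine div_le_one_of_le₀ ((abs_real_inner_le_norm s x).trans ?_) (norm_nonneg _)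
    exact mul_le_of_le_one_right (norm_nonneg _) hx
  obtain ⟨h1, h2⟩ := abs_le.1 habs
  have hsq : ‖s + t • x‖ ^ 2 ≤
      (1 + w) / 2 * (‖s‖ + t) ^ 2 + (1 - w) / 2 * (‖s‖ - t) ^ 2 := by
    rw [norm_add_sq_real, inner_smul_right, hsx, norm_smul, mul_pow, Real.norm_eq_abs, sq_abs]
    have : t ^ 2 * ‖x‖ ^ 2 ≤ t ^ 2 := mul_le_of_le_one_right (sq_nonneg _)
      (pow_le_one₀ (norm_nonneg _) hx)
    nlinarith
  have hc := convexOn_cosh_sqrt.2 (Set.mem_Ici.2 (sq_nonneg (‖s‖ + t)))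
    (Set.mem_Ici.2 (sq_nonneg (‖s‖ - t)))
    (by linarith : 0 ≤ (1 + w) / 2) (by linarith : 0 ≤ (1 - w) / 2) (by ring)
  simp only [smul_eq_mul, Real.sqrt_sq_eq_abs, Real.cosh_abs] at hc
  refine le_trans ?_ hc
  rw [Real.cosh_le_cosh, abs_of_nonneg (norm_nonneg _), abs_of_nonneg (Real.sqrt_nonneg _)]
  exact Real.le_sqrt_of_sq_le hsq

section Steps
variable {Y : Type*} [MeasurableSpace Y] {E : Type*} [NormedAddCommGroup E]
  [InnerProductSpace ℝ E]

/-- One step of the `cosh` supermartingale. Rescaling `X` by `c` gives an upper bound affine in `⟨s,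
X⟩`; its linear part integrates to zero and its constant part is `cosh(l‖s‖) cosh(lc)`. Centring is
needed only in the direction `s`. -/
theorem lintegral_cosh_norm_add_le_of_bounded (ν : Measure Y) [IsProbabilityMeasure ν] (X : Y → E)
    (s : E) {c : ℝ} (hc : 0 ≤ c) (hX : ∀ᵐ y ∂ν, ‖X y‖ ≤ c)
    (hint : Integrable (fun y => inner ℝ s (X y)) ν) (hzero : ∫ y, inner ℝ s (X y) ∂ν = 0)
    (l : ℝ) (hl : 0 ≤ l) :
    ∫⁻ y, ENNReal.ofReal (Real.cosh (l * ‖s + X y‖)) ∂ν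
      ≤ ENNReal.ofReal (Real.exp (l ^ 2 * c ^ 2 / 2)) *
        ENNReal.ofReal (Real.cosh (l * ‖s‖)) := by
  set k : ℝ := (Real.cosh (l * ‖s‖ + l * c) - Real.cosh (l * ‖s‖ - l * c)) / 2
    * (l * c⁻¹ / (l * ‖s‖)) with hk
  set K : ℝ := Real.cosh (l * ‖s‖) * Real.cosh (l * c) with hK
  have hpt : ∀ᵐ y ∂ν, Real.cosh (l * ‖s + X y‖) ≤ K + k * inner ℝ s (X y) := by
    filter_upwards [hX] with y hy
    -- For `c = 0` the increment itself vanishes, so the rescaling survives division by zero.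
    have hcx : c • (c⁻¹ • X y) = X y := by
      rcases eq_or_ne c 0 with rfl | h
      · have : X y = 0 := by simpa using hy
        simp [this]
      · rw [smul_smul, mul_inv_cancel₀ h, one_smul]
    have hn : ‖c⁻¹ • X y‖ ≤ 1 := by
      rw [norm_smul, norm_inv, Real.norm_eq_abs, abs_of_nonneg hc, ← div_eq_inv_mul]
      exact div_le_one_of_le₀ hy hc
    have h := cosh_norm_add_smul_le (l • s) (c⁻¹ • X y) hn (l * c)
    rw [mul_smul, hcx, ← smul_add, norm_smul, norm_smul, Real.norm_eq_abs, abs_of_nonneg hl,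
      inner_smul_left, inner_smul_right] at h
    refine h.trans (le_of_eq ?_)
    have hKe : K = (Real.cosh (l * ‖s‖ + l * c) + Real.cosh (l * ‖s‖ - l * c)) / 2 := by
      rw [Real.cosh_add, Real.cosh_sub, hK]; ring
    rw [hKe, hk]
    simp only [conj_trivial]
    ring
  have hint' : Integrable (fun y => K + k * inner ℝ s (X y)) ν :=
    (integrable_const K).add (hint.const_mul k)
  calc ∫⁻ y, ENNReal.ofReal (Real.cosh (l * ‖s + X y‖)) ∂ν
      ≤ ∫⁻ y, ENNReal.ofReal (K + k * inner ℝ s (X y)) ∂ν :=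
        lintegral_mono_ae (hpt.mono fun y hy => ENNReal.ofReal_le_ofReal hy)
    _ = ENNReal.ofReal (∫ y, K + k * inner ℝ s (X y) ∂ν) := by
        rw [ofReal_integral_eq_lintegral_ofReal hint']
        filter_upwards [hpt] with y hy
        exact (Real.cosh_pos _).le.trans hy
    _ = ENNReal.ofReal K := by
        rw [integral_add (integrable_const K) (hint.const_mul k), integral_const_mul k, hzero]
        simp
    _ ≤ _ := by
        rw [← ENNReal.ofReal_mul (Real.exp_pos _).le]
        refine ENNReal.ofReal_le_ofReal ?_
        rw [hK, mul_comm]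
        have := Real.cosh_le_exp_half_sq (l * c)
        rw [mul_pow] at this
        gcongr

/-- The direction `x` is fixed and only the scalar is random, so the weights `(1 ± w)/2` are
constants. The claim reduces to the moment generating function at `l` and `-l`. -/
theorem lintegral_cosh_norm_add_smul_le_of_subgaussian (ν : Measure ℝ) [IsProbabilityMeasure ν]
    {R : ℝ} (hν : HasSubgaussianMGF id ⟨R ^ 2, sq_nonneg R⟩ ν) (s x : E) (hx : ‖x‖ ≤ 1)
    (l : ℝ) (hl : 0 ≤ l) :
    ∫⁻ y, ENNReal.ofReal (Real.cosh (l * ‖s + y • x‖)) ∂ν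
      ≤ ENNReal.ofReal (Real.exp (l ^ 2 * R ^ 2 / 2)) *
        ENNReal.ofReal (Real.cosh (l * ‖s‖)) := by
  have hm : ∀ u : ℝ, ∫ y, Real.exp (u * y) ∂ν ≤ Real.exp (u ^ 2 * R ^ 2 / 2) := fun u => by
    refine (hν.mgf_le u).trans_eq ?_
    rw [mul_comm]
    rfl
  have hi : ∀ u : ℝ, Integrable (fun y => Real.exp (u * y)) ν := fun u =>
    hν.integrable_exp_mul u
  have hcosh : ∀ a u y : ℝ, Real.cosh (a + u * y) =
      Real.exp a / 2 * Real.exp (u * y) + Real.exp (-a) / 2 * Real.exp (-u * y) := by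
    intro a u y
    rw [Real.cosh_eq, neg_add, Real.exp_add, Real.exp_add, neg_mul]; ring
  have hci : ∀ a u : ℝ, Integrable (fun y => Real.cosh (a + u * y)) ν := fun a u => by
    simp_rw [hcosh]
    exact ((hi u).const_mul _).add ((hi (-u)).const_mul _)
  have hcb : ∀ a u : ℝ, ∫ y, Real.cosh (a + u * y) ∂ν
      ≤ Real.exp (u ^ 2 * R ^ 2 / 2) * Real.cosh a := fun a u => by
    simp_rw [hcosh]
    rw [integral_add ((hi u).const_mul _) ((hi (-u)).const_mul _), integral_const_mul,
      integral_const_mul, Real.cosh_eq]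
    have h1 := hm u
    have h2 := hm (-u)
    rw [neg_sq] at h2
    have := mul_le_mul_of_nonneg_left h1 (Real.exp_pos a).le
    have := mul_le_mul_of_nonneg_left h2 (Real.exp_pos (-a)).le
    linarith
  set w := inner ℝ (l • s) x / ‖l • s‖ with hw
  have habs : |w| ≤ 1 := by
    rw [hw, abs_div, abs_norm]
    refine div_le_one_of_le₀ ((abs_real_inner_le_norm _ x).trans ?_) (norm_nonneg _)
    exact mul_le_of_le_one_right (norm_nonneg _) hx
  obtain ⟨h1, h2⟩ := abs_le.1 habs
  have hpt : ∀ y, Real.cosh (l * ‖s + y • x‖) ≤ (1 + w) / 2 * Real.cosh (l * ‖s‖ + l * y)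
      + (1 - w) / 2 * Real.cosh (l * ‖s‖ + (-l) * y) := fun y => by
    have h := cosh_norm_add_smul_le (l • s) x hx (l * y)
    rw [mul_smul, ← smul_add, norm_smul, Real.norm_eq_abs, abs_of_nonneg hl, ← hw, norm_smul,
      Real.norm_eq_abs, abs_of_nonneg hl] at h
    rwa [neg_mul, ← sub_eq_add_neg]
  have hint' := ((hci (l * ‖s‖) l).const_mul ((1 + w) / 2)).add
    ((hci (l * ‖s‖) (-l)).const_mul ((1 - w) / 2))
  calc ∫⁻ y, ENNReal.ofReal (Real.cosh (l * ‖s + y • x‖)) ∂ν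
      ≤ ∫⁻ y, ENNReal.ofReal ((1 + w) / 2 * Real.cosh (l * ‖s‖ + l * y)
      + (1 - w) / 2 * Real.cosh (l * ‖s‖ + (-l) * y)) ∂ν :=
        lintegral_mono fun y => ENNReal.ofReal_le_ofReal (hpt y)
    _ = ENNReal.ofReal (∫ y, ((1 + w) / 2 * Real.cosh (l * ‖s‖ + l * y)
      + (1 - w) / 2 * Real.cosh (l * ‖s‖ + (-l) * y)) ∂ν) := by
        exact (ofReal_integral_eq_lintegral_ofReal hint'
          (Filter.Eventually.of_forall fun y => (Real.cosh_pos _).le.trans (hpt y))).symm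
    _ ≤ _ := by
        rw [← ENNReal.ofReal_mul (Real.exp_pos _).le]
        refine ENNReal.ofReal_le_ofReal ?_
        rw [integral_add ((hci _ _).const_mul _) ((hci _ _).const_mul _), integral_const_mul,
          integral_const_mul]
        have h3 := hcb (l * ‖s‖) l
        have h4 := hcb (l * ‖s‖) (-l)
        rw [neg_sq] at h4
        have := mul_le_mul_of_nonneg_left h3 (by linarith : 0 ≤ (1 + w) / 2)
        have := mul_le_mul_of_nonneg_left h4 (by linarith : 0 ≤ (1 - w) / 2)
        linarith

end Steps

theorem measure_norm_gt_le_of_lintegral_cosh_le {Ω : Type*} [MeasurableSpace Ω] (μ : Measure Ω)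
    {E : Type*} [NormedAddCommGroup E] (S : Ω → E) (hS : AEMeasurable (fun ω => ‖S ω‖) μ)
    {v ι : ℝ} (hv : 0 ≤ v) (hι : 0 < ι)
    (h : ∀ l : ℝ, 0 ≤ l → ∫⁻ ω, ENNReal.ofReal (Real.cosh (l * ‖S ω‖)) ∂μ
      ≤ ENNReal.ofReal (Real.exp (l ^ 2 * v / 2))) :
    μ {ω | √(2 * v * ι) < ‖S ω‖} ≤ ENNReal.ofReal (2 * Real.exp (-ι)) := by
  have key : ∀ r : ℝ, √(2 * v * ι) < r →
      μ {ω | r ≤ ‖S ω‖} ≤ ENNReal.ofReal (2 * Real.exp (-ι)) := by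
    intro r hr
    have hr0 : 0 < r := (Real.sqrt_nonneg _).trans_lt hr
    have hr2 : 2 * v * ι < r ^ 2 := (Real.sqrt_lt' hr0).1 hr
    obtain ⟨l, hl, hle⟩ : ∃ l : ℝ, 0 ≤ l ∧ l ^ 2 * v / 2 - l * r ≤ -ι := by
      rcases hv.eq_or_lt with rfl | hv
      -- Without variance there is no optimal `l`; any sufficiently large one works because `r > 0`.
      -- Otherwise the usual optimum `r / v` is taken.
      · exact ⟨ι / r, by positivity, by field_simp; simp⟩
      · refine ⟨r / v, by positivity, ?_⟩
        have : (r / v) ^ 2 * v / 2 - r / v * r = -(r ^ 2 / (2 * v)) := by field_simp; ring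
        rw [this, neg_le_neg_iff, le_div_iff₀ (by positivity)]
        linarith
    have hmk := mul_meas_ge_le_lintegral₀ (μ := μ)
      (f := fun ω => ENNReal.ofReal (Real.cosh (l * ‖S ω‖)))
      (Measurable.comp_aemeasurable (g := fun u : ℝ => ENNReal.ofReal (Real.cosh (l * u)))
        (by fun_prop) hS) (ENNReal.ofReal (Real.exp (l * r) / 2))
    have hsub : {ω | r ≤ ‖S ω‖} ⊆ {ω | ENNReal.ofReal (Real.exp (l * r) / 2)
        ≤ ENNReal.ofReal (Real.cosh (l * ‖S ω‖))} := by
      intro ω hω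
      refine ENNReal.ofReal_le_ofReal ?_
      rw [Real.cosh_eq]
      have : Real.exp (l * r) ≤ Real.exp (l * ‖S ω‖) :=
        Real.exp_le_exp.2 (mul_le_mul_of_nonneg_left hω hl)
      have := (Real.exp_pos (-(l * ‖S ω‖))).le
      linarith
    have h1 : ENNReal.ofReal (Real.exp (l * r) / 2) * μ {ω | r ≤ ‖S ω‖}
        ≤ ENNReal.ofReal (Real.exp (l ^ 2 * v / 2)) :=
      ((mul_le_mul_right (measure_mono hsub) _).trans hmk).trans (h l hl)
    have h2 := ENNReal.le_div_iff_mul_le (Or.inl (by simp; positivity)) (Or.inl (by simp)) |>.2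
      ((mul_comm _ _).trans_le h1)
    refine h2.trans ?_
    rw [← ENNReal.ofReal_div_of_pos (by positivity)]
    refine ENNReal.ofReal_le_ofReal ?_
    have : Real.exp (l ^ 2 * v / 2) / (Real.exp (l * r) / 2)
      = 2 * Real.exp (l ^ 2 * v / 2 - l * r) := by rw [Real.exp_sub]; field_simp
    rw [this]
    gcongr
  -- The Chernoff argument needs `r` strictly above the threshold, so the open event is exhausted by
  -- closed ones.
  have hU : {ω | √(2 * v * ι) < ‖S ω‖}
      = ⋃ n : ℕ, {ω | √(2 * v * ι) + 1 / ((n : ℝ) + 1) ≤ ‖S ω‖} := by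
    ext ω
    simp only [Set.mem_ofPred_eq, Set.mem_iUnion]
    constructor
    · intro hω
      obtain ⟨n, hn⟩ := exists_nat_one_div_lt (sub_pos.2 hω)
      exact ⟨n, by linarith⟩
    · rintro ⟨n, hn⟩
      have : 0 < 1 / ((n : ℝ) + 1) := by positivity
      linarith
  rw [hU, Monotone.measure_iUnion]
  · exact iSup_le fun n => key _ (by have : 0 < 1 / ((n : ℝ) + 1) := by positivity
                                     linarith)
  · intro n m hnm ω hω
    simp only [Set.mem_ofPred_eq] at hω ⊢
    refine le_trans ?_ hω
    have : 1 / ((m : ℝ) + 1) ≤ 1 / ((n : ℝ) + 1) := by gcongr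
    linarith

theorem lintegral_cosh_norm_le_of_step {Ω : Type*} [MeasurableSpace Ω] (μ : Measure Ω)
    [IsProbabilityMeasure μ] {E : Type*} [NormedAddCommGroup E] (S : ℕ → Ω → E)
    (h0 : ∀ ω, S 0 ω = 0) (c l : ℝ) (n : ℕ)
    (hstep : ∀ t < n, ∫⁻ ω, ENNReal.ofReal (Real.cosh (l * ‖S (t + 1) ω‖)) ∂μ
      ≤ ENNReal.ofReal (Real.exp (l ^ 2 * c ^ 2 / 2)) *
        ∫⁻ ω, ENNReal.ofReal (Real.cosh (l * ‖S t ω‖)) ∂μ) :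
    ∫⁻ ω, ENNReal.ofReal (Real.cosh (l * ‖S n ω‖)) ∂μ
      ≤ ENNReal.ofReal (Real.exp (l ^ 2 * (n * c ^ 2) / 2)) := by
  induction n with
  | zero => simp [h0]
  | succ n ih =>
    refine (hstep n (Nat.lt_succ_self n)).trans ?_
    refine (mul_le_mul_right (ih fun t ht => hstep t (ht.trans (Nat.lt_succ_self n))) _).trans ?_
    rw [← ENNReal.ofReal_mul (Real.exp_pos _).le, ← Real.exp_add]
    refine ENNReal.ofReal_le_ofReal (Real.exp_le_exp.2 (le_of_eq ?_))
    push_cast; ring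

/-! ### Conditional laws given by a kernel -/

section Disintegration

variable {Ω Ω' Y : Type*} [mΩ : MeasurableSpace Ω] [mΩ' : MeasurableSpace Ω'] [MeasurableSpace Y]
  {μ : Measure Ω} [IsProbabilityMeasure μ] {p : Ω → Ω'} {ξ : Ω → Y} {κ : Kernel Ω' Y}
  [IsMarkovKernel κ]

/-- In the application `p` is the identity from `Ω` to `Ω` with the coarser σ-algebra of the
history. Conditioning on the history thereby becomes integration against an explicit kernel, with no
assumption on `Ω`. Rectangles suffice to identify the joint law. -/
theorem map_prodMk_eq_compProd (hp : Measurable p) (hξ : Measurable ξ)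
    (h : ∀ A, MeasurableSet A → ∀ B, MeasurableSet B →
      μ (p ⁻¹' A ∩ ξ ⁻¹' B) = ∫⁻ ω in p ⁻¹' A, κ (p ω) B ∂μ) :
    μ.map (fun ω => (p ω, ξ ω)) = (μ.map p) ⊗ₘ κ := by
  have := Measure.isProbabilityMeasure_map (μ := μ) hp.aemeasurable
  have := Measure.isProbabilityMeasure_map (μ := μ) (hp.prodMk hξ).aemeasurable
  refine Measure.ext_prod fun {A B} hA hB => ?_
  rw [Measure.map_apply (hp.prodMk hξ) (hA.prod hB), Measure.compProd_apply_prod hA hB,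
    setLIntegral_map hA (κ.measurable_coe hB) hp, ← h A hA B hB]
  rfl

theorem lintegral_comp_eq_of_map_eq (hp : Measurable p) (hξ : Measurable ξ)
    (h : μ.map (fun ω => (p ω, ξ ω)) = (μ.map p) ⊗ₘ κ) {f : Ω' × Y → ENNReal}
    (hf : Measurable f) :
    ∫⁻ ω, f (p ω, ξ ω) ∂μ = ∫⁻ ω, ∫⁻ y, f (p ω, y) ∂(κ (p ω)) ∂μ := by
  have := Measure.isProbabilityMeasure_map (μ := μ) hp.aemeasurable
  rw [← lintegral_map hf (hp.prodMk hξ), h, Measure.lintegral_compProd hf,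
    lintegral_map (f := fun a => ∫⁻ y, f (a, y) ∂(κ a)) hf.lintegral_kernel_prod_right' hp]

theorem ae_ae_of_map_eq (hp : Measurable p) (hξ : Measurable ξ)
    (h : μ.map (fun ω => (p ω, ξ ω)) = (μ.map p) ⊗ₘ κ) {P : Ω' × Y → Prop}
    (hP : MeasurableSet {z | P z}) (hae : ∀ᵐ ω ∂μ, P (p ω, ξ ω)) :
    ∀ᵐ ω ∂μ, ∀ᵐ y ∂(κ (p ω)), P (p ω, y) := by
  have := Measure.isProbabilityMeasure_map (μ := μ) hp.aemeasurable
  have h1 : ∀ᵐ z ∂(μ.map (fun ω => (p ω, ξ ω))), P z :=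
    (ae_map_iff (hp.prodMk hξ).aemeasurable hP).2 hae
  rw [h] at h1
  exact ae_of_ae_map hp.aemeasurable (Measure.ae_ae_of_ae_compProd h1)

/-- Links the abstract conditional expectation in `Run.VarianceBound` to the kernel mean used in the
concentration argument. -/
theorem condExp_comap_ae_eq_integral_kernel (hp : Measurable p) (hξ : Measurable ξ)
    (h : μ.map (fun ω => (p ω, ξ ω)) = (μ.map p) ⊗ₘ κ) {g : Ω' × Y → ℝ} (hg : Measurable g)
    (hint : Integrable (fun ω => g (p ω, ξ ω)) μ) :
    μ[fun ω => g (p ω, ξ ω) | mΩ'.comap p] =ᵐ[μ] fun ω => ∫ y, g (p ω, y) ∂(κ (p ω)) := by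
  have := Measure.isProbabilityMeasure_map (μ := μ) hp.aemeasurable
  have hpm : Measurable fun ω => (p ω, ξ ω) := hp.prodMk hξ
  have hI : Integrable g ((μ.map p) ⊗ₘ κ) := by
    rw [← h, integrable_map_measure hg.aestronglyMeasurable hpm.aemeasurable]
    exact hint
  have hsm : StronglyMeasurable fun ω => ∫ y, g (ω, y) ∂(κ ω) :=
    hg.stronglyMeasurable.integral_kernel_prod_right'
  symm
  refine ae_eq_condExp_of_forall_setIntegral_eq hp.comap_le hint ?_ ?_ ?_
  · intro s _ _
    have h2 := Integrable.integral_compProd (κ := Kernel.const Unit (μ.map p))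
      (η := Kernel.prodMkLeft Unit κ) (a := ()) hI
    exact (Integrable.comp_measurable (f := p) h2 hp).integrableOn
  · rintro _ ⟨s, hs, rfl⟩ _
    have h3 := Measure.setIntegral_compProd hs MeasurableSet.univ hI.integrableOn
    simp only [Measure.restrict_univ] at h3
    rw [← h, setIntegral_map (hs.prod MeasurableSet.univ) hg.aestronglyMeasurable hpm.aemeasurable,
      setIntegral_map hs hsm.aestronglyMeasurable hp.aemeasurable] at h3
    rw [Set.mk_preimage_prod] at h3
    simpa using h3.symm
  · exact (hsm.comp_measurable (comap_measurable p)).aestronglyMeasurable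

end Disintegration

/-! ### Quadratic forms of real matrices -/

section QuadraticForms

variable {n : Type*} [Fintype n]

theorem dotProduct_mulVec_comm {B : Matrix n n ℝ} (hB : B.IsSymm) (x y : n → ℝ) :
    x ⬝ᵥ (B *ᵥ y) = y ⬝ᵥ (B *ᵥ x) := by
  rw [Matrix.dotProduct_mulVec, ← Matrix.mulVec_transpose, hB, dotProduct_comm]

/-- Cauchy–Schwarz: the form at `x + t y` is a nonnegative quadratic in `t`, so its discriminant is
nonpositive. -/
theorem dotProduct_mulVec_sq_le {B : Matrix n n ℝ} (hB : B.PosSemidef) (x y : n → ℝ) :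
    (x ⬝ᵥ (B *ᵥ y)) ^ 2 ≤ (x ⬝ᵥ (B *ᵥ x)) * (y ⬝ᵥ (B *ᵥ y)) := by
  have hsymm : B.IsSymm := by
    simpa [Matrix.IsHermitian, Matrix.IsSymm] using hB.isHermitian
  have h : ∀ t : ℝ, 0 ≤ (y ⬝ᵥ (B *ᵥ y)) * (t * t) + 2 * (x ⬝ᵥ (B *ᵥ y)) * t
      + x ⬝ᵥ (B *ᵥ x) := fun t => by
    have := hB.dotProduct_mulVec_nonneg (x + t • y)
    simp only [star_trivial, Matrix.mulVec_add, Matrix.mulVec_smul, add_dotProduct,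
      dotProduct_add, smul_dotProduct, dotProduct_smul, smul_eq_mul,
      dotProduct_mulVec_comm hsymm y x] at this
    linarith
  have := discrim_le_zero h
  rw [discrim] at this
  linarith

theorem form_vecMulVec_self (x y : n → ℝ) :
    y ⬝ᵥ (Matrix.vecMulVec x x *ᵥ y) = (x ⬝ᵥ y) ^ 2 := by
  rw [Matrix.vecMulVec_mulVec, op_smul_eq_smul, dotProduct_smul, smul_eq_mul, dotProduct_comm y x,
    sq]

theorem norm_toLp_mulVec_le (A : Matrix n n ℝ) (x : n → ℝ) :
    ‖WithLp.toLp 2 (A *ᵥ x)‖ ≤ ‖A‖ * ‖WithLp.toLp 2 x‖ := by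
  have := Matrix.frobenius_norm_mul A (Matrix.replicateCol Unit x)
  rwa [← Matrix.replicateCol_mulVec, Matrix.frobenius_norm_replicateCol,
    Matrix.frobenius_norm_replicateCol] at this

theorem dotProduct_self_eq_norm_sq (x : n → ℝ) : x ⬝ᵥ x = ‖WithLp.toLp 2 x‖ ^ 2 := by
  rw [← real_inner_self_eq_norm_sq, EuclideanSpace.inner_eq_star_dotProduct]
  simp

theorem abs_dotProduct_le (x y : n → ℝ) :
    |x ⬝ᵥ y| ≤ ‖WithLp.toLp 2 x‖ * ‖WithLp.toLp 2 y‖ := by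
  have := abs_real_inner_le_norm (WithLp.toLp 2 y) (WithLp.toLp 2 x)
  rw [EuclideanSpace.inner_eq_star_dotProduct] at this
  simpa [mul_comm] using this

theorem abs_form_le_frobenius (A : Matrix n n ℝ) (x : n → ℝ) :
    |x ⬝ᵥ (A *ᵥ x)| ≤ ‖A‖ * (x ⬝ᵥ x) := by
  rw [dotProduct_self_eq_norm_sq]
  refine (abs_dotProduct_le _ _).trans ?_
  have := mul_le_mul_of_nonneg_left (norm_toLp_mulVec_le A x) (norm_nonneg (WithLp.toLp 2 x))
  linarith

theorem frobenius_norm_sq (A : Matrix n n ℝ) : ‖A‖ ^ 2 = ∑ i, ∑ j, A i j ^ 2 := by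
  rw [Matrix.frobenius_norm_def, ← Real.sqrt_eq_rpow, Real.sq_sqrt]
  · simp
  · positivity

/-- Pythagoras: symmetric and antisymmetric matrices are orthogonal for the Frobenius inner product.
-/
theorem frobenius_norm_symmetrization_sq (A B : Matrix n n ℝ) (hB : B.IsSymm) :
    ‖A - B‖ ^ 2 = ‖(2⁻¹ : ℝ) • (A + Aᵀ) - B‖ ^ 2 + ‖(2⁻¹ : ℝ) • (A - Aᵀ)‖ ^ 2 := by
  simp only [frobenius_norm_sq, Matrix.sub_apply, Matrix.smul_apply, Matrix.add_apply,
    Matrix.transpose_apply, smul_eq_mul]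
  have hs : ∀ i j, B i j = B j i := fun i j => (hB.apply i j).symm
  have h1 : ∑ i, ∑ j, (A i j - B i j) ^ 2
      = ∑ i, ∑ j, ((A i j - B i j) ^ 2 + (A j i - B i j) ^ 2) / 2 := by
    have h2 : ∑ i, ∑ j, (A j i - B i j) ^ 2 = ∑ i, ∑ j, (A i j - B i j) ^ 2 := by
      rw [Finset.sum_comm]
      refine Finset.sum_congr rfl fun i _ => Finset.sum_congr rfl fun j _ => ?_
      rw [hs j i]
    simp only [add_div, Finset.sum_add_distrib, ← Finset.sum_div, h2]
    ring
  rw [h1, ← Finset.sum_add_distrib]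
  refine Finset.sum_congr rfl fun i _ => ?_
  rw [← Finset.sum_add_distrib]
  refine Finset.sum_congr rfl fun j _ => ?_
  ring

variable [DecidableEq n]

/-- With `w = A⁻¹x`, Cauchy–Schwarz for `B` gives `(w·x)² ≤ (w·Bw)(x·B⁻¹x) ≤ (w·Aw)(x·B⁻¹x)`, and
`w·Aw = w·x` can be cancelled. -/
theorem dotProduct_inv_mulVec_anti {A B : Matrix n n ℝ} (hA : A.PosDef) (hB : B.PosDef)
    (h : ∀ x, x ⬝ᵥ (B *ᵥ x) ≤ x ⬝ᵥ (A *ᵥ x)) (x : n → ℝ) :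
    x ⬝ᵥ (A⁻¹ *ᵥ x) ≤ x ⬝ᵥ (B⁻¹ *ᵥ x) := by
  set w := A⁻¹ *ᵥ x with hw
  have hAw : A *ᵥ w = x := by
    rw [hw, Matrix.mulVec_mulVec, Matrix.mul_nonsing_inv _ hA.det_pos.ne'.isUnit,
      Matrix.one_mulVec]
  have hBx : B *ᵥ (B⁻¹ *ᵥ x) = x := by
    rw [Matrix.mulVec_mulVec, Matrix.mul_nonsing_inv _ hB.det_pos.ne'.isUnit, Matrix.one_mulVec]
  have h1 := dotProduct_mulVec_sq_le hB.posSemidef w (B⁻¹ *ᵥ x)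
  rw [hBx, dotProduct_comm (B⁻¹ *ᵥ x) x] at h1
  have h2 := h w
  rw [hAw] at h2
  have h3 := hB.inv.posSemidef.dotProduct_mulVec_nonneg x
  rw [star_trivial] at h3
  have h4 := hB.posSemidef.dotProduct_mulVec_nonneg w
  rw [star_trivial] at h4
  rw [dotProduct_comm x w]
  by_contra! hc
  nlinarith

theorem dotProduct_inv_mulVec_le {A : Matrix n n ℝ} (hA : A.PosDef) {a : ℝ} (ha : 0 < a)
    (h : ∀ x, a * (x ⬝ᵥ x) ≤ x ⬝ᵥ (A *ᵥ x)) (x : n → ℝ) :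
    x ⬝ᵥ (A⁻¹ *ᵥ x) ≤ (x ⬝ᵥ x) / a := by
  have hB : (a • (1 : Matrix n n ℝ)).PosDef := Matrix.PosDef.one.smul ha
  refine (dotProduct_inv_mulVec_anti hA hB (fun x => ?_) x).trans (le_of_eq ?_)
  · simpa [Matrix.smul_mulVec] using h x
  · have : (a • (1 : Matrix n n ℝ))⁻¹ = a⁻¹ • 1 := by
      refine Matrix.inv_eq_right_inv ?_
      rw [Matrix.smul_mul, Matrix.mul_smul, smul_smul, mul_inv_cancel₀ ha.ne', one_smul, one_mul]
    rw [this, Matrix.smul_mulVec, Matrix.one_mulVec, dotProduct_smul, smul_eq_mul]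
    ring

theorem posDef_of_le_form {A : Matrix n n ℝ} (hA : A.IsSymm) {a : ℝ} (ha : 0 < a)
    (h : ∀ x, a * (x ⬝ᵥ x) ≤ x ⬝ᵥ (A *ᵥ x)) : A.PosDef := by
  refine Matrix.PosDef.of_dotProduct_mulVec_pos (by simpa [Matrix.IsHermitian, Matrix.IsSymm] using hA)
    fun x hx => ?_
  rw [star_trivial]
  refine lt_of_lt_of_le (mul_pos ha ?_) (h x)
  have := (Matrix.PosDef.one (n := n) (R := ℝ)).dotProduct_mulVec_pos hx
  simpa using this

theorem det_le_pow_of_form_le {A : Matrix n n ℝ} (hA : A.PosDef) {c : ℝ}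
    (h : ∀ x, x ⬝ᵥ (A *ᵥ x) ≤ c * (x ⬝ᵥ x)) : A.det ≤ c ^ Fintype.card n := by
  rw [hA.isHermitian.det_eq_prod_eigenvalues, ← Finset.card_univ, ← Finset.prod_const]
  refine Finset.prod_le_prod (fun i _ => (hA.eigenvalues_pos i).le) fun i _ => ?_
  have h1 := hA.isHermitian.eigenvalues_eq i
  have h2 := hA.isHermitian.eigenvectorBasis.orthonormal.1 i
  have h3 := h (hA.isHermitian.eigenvectorBasis i).ofLp
  have h4 : (hA.isHermitian.eigenvectorBasis i).ofLp ⬝ᵥ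
      (hA.isHermitian.eigenvectorBasis i).ofLp = 1 := by
    have := real_inner_self_eq_norm_sq (hA.isHermitian.eigenvectorBasis i)
    rw [h2, EuclideanSpace.inner_eq_star_dotProduct] at this
    simpa using this
  rw [h4, mul_one] at h3
  simpa [h1] using h3

theorem det_add_vecMulVec_self {A : Matrix n n ℝ} (hA : IsUnit A.det) (x : n → ℝ) :
    (A + Matrix.vecMulVec x x).det = A.det * (1 + x ⬝ᵥ (A⁻¹ *ᵥ x)) := by
  rw [Matrix.vecMulVec_eq Unit, Matrix.det_add_replicateCol_mul_replicateRow hA]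
  congr 1
  rw [Matrix.det_unique, Matrix.add_apply, Matrix.one_apply_eq, Matrix.mul_assoc, ← Matrix.replicateCol_mulVec]
  rfl

theorem sq_dotProduct_le (x y : n → ℝ) : (x ⬝ᵥ y) ^ 2 ≤ (x ⬝ᵥ x) * (y ⬝ᵥ y) := by
  have := dotProduct_mulVec_sq_le (Matrix.PosSemidef.one (n := n) (R := ℝ)) x y
  simpa using this

/-- The elliptical potential lemma. Adding `x xᵀ` multiplies the determinant by `1 + u` with `u =
‖x‖²_{A⁻¹}`; since `ℓ ≥ 1` forces `u ≤ 1`, one has `u ≤ 2 log(1 + u)`, and the logarithms of the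
determinants telescope. -/
theorem sum_dotProduct_inv_mulVec_le (x : ℕ → n → ℝ) (hx : ∀ t, x t ⬝ᵥ x t ≤ 1) {ℓ : ℝ}
    (hℓ : 1 ≤ ℓ) (T : ℕ) :
    ∑ t ∈ Finset.range T, x t ⬝ᵥ
        ((ℓ • (1 : Matrix n n ℝ) + ∑ s ∈ Finset.range t, Matrix.vecMulVec (x s) (x s))⁻¹ *ᵥ x t)
      ≤ 2 * Fintype.card n * Real.log (1 + T / ℓ) := by
  have hℓ0 : 0 < ℓ := by linarith
  set A : ℕ → Matrix n n ℝ := fun t =>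
    ℓ • (1 : Matrix n n ℝ) + ∑ s ∈ Finset.range t, Matrix.vecMulVec (x s) (x s) with hAdef
  have hform : ∀ t y, y ⬝ᵥ (A t *ᵥ y) = ℓ * (y ⬝ᵥ y) + ∑ s ∈ Finset.range t, (x s ⬝ᵥ y) ^ 2 := by
    intro t y
    simp only [hAdef, Matrix.add_mulVec, Matrix.smul_mulVec, Matrix.one_mulVec, dotProduct_add,
      dotProduct_smul, smul_eq_mul, Matrix.sum_mulVec, dotProduct_sum, form_vecMulVec_self]
  have hsymm : ∀ t, (A t).IsSymm := by
    intro t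
    simp only [hAdef, Matrix.IsSymm, Matrix.transpose_add, Matrix.transpose_smul,
      Matrix.transpose_one, Matrix.transpose_sum, Matrix.transpose_vecMulVec]
  have hlow : ∀ t y, ℓ * (y ⬝ᵥ y) ≤ y ⬝ᵥ (A t *ᵥ y) := fun t y => by
    rw [hform]
    exact le_add_of_nonneg_right (Finset.sum_nonneg fun s _ => sq_nonneg _)
  have hpd : ∀ t, (A t).PosDef := fun t => posDef_of_le_form (hsymm t) hℓ0 (hlow t)
  have hstep : ∀ t, x t ⬝ᵥ ((A t)⁻¹ *ᵥ x t)
      ≤ 2 * (Real.log (A (t + 1)).det - Real.log (A t).det) := by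
    intro t
    set u := x t ⬝ᵥ ((A t)⁻¹ *ᵥ x t) with hu
    have hu0 : 0 ≤ u := by
      have := (hpd t).inv.posSemidef.dotProduct_mulVec_nonneg (x t)
      rwa [star_trivial] at this
    have hu1 : u ≤ 1 := by
      refine (dotProduct_inv_mulVec_le (hpd t) hℓ0 (hlow t) (x t)).trans ?_
      rw [div_le_one hℓ0]
      exact (hx t).trans hℓ
    have hA1 : A (t + 1) = A t + Matrix.vecMulVec (x t) (x t) := by
      simp only [hAdef, Finset.sum_range_succ, add_assoc]
    rw [hA1, det_add_vecMulVec_self (hpd t).det_pos.ne'.isUnit,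
      Real.log_mul (hpd t).det_pos.ne' (by positivity), add_sub_cancel_left]
    refine le_trans ?_ (mul_le_mul_of_nonneg_left (Real.le_log_one_add_of_nonneg hu0) zero_le_two)
    rw [← mul_div_assoc, le_div_iff₀ (by positivity)]
    nlinarith
  have h0 : (A 0).det = ℓ ^ Fintype.card n := by
    simp [hAdef]
  have hT : (A T).det ≤ (ℓ + T) ^ Fintype.card n := by
    refine det_le_pow_of_form_le (hpd T) fun y => ?_
    rw [hform, add_mul, add_le_add_iff_left]
    have hyy : 0 ≤ y ⬝ᵥ y := by
      simpa using dotProduct_star_self_nonneg y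
    calc ∑ s ∈ Finset.range T, (x s ⬝ᵥ y) ^ 2 ≤ ∑ _s ∈ Finset.range T, y ⬝ᵥ y :=
          Finset.sum_le_sum fun s _ => (sq_dotProduct_le _ _).trans
            (mul_le_of_le_one_left hyy (hx s))
      _ = T * (y ⬝ᵥ y) := by simp
  calc ∑ t ∈ Finset.range T, x t ⬝ᵥ ((A t)⁻¹ *ᵥ x t)
      ≤ ∑ t ∈ Finset.range T, 2 * (Real.log (A (t + 1)).det - Real.log (A t).det) :=
        Finset.sum_le_sum fun t _ => hstep t
    _ = 2 * (Real.log (A T).det - Real.log (A 0).det) := by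
        rw [← Finset.mul_sum, Finset.sum_range_sub (fun t => Real.log (A t).det)]
    _ ≤ 2 * (Real.log ((ℓ + T) ^ Fintype.card n) - Real.log (ℓ ^ Fintype.card n)) := by
        rw [h0]
        have := Real.log_le_log (hpd T).det_pos hT
        linarith
    _ = _ := by
        rw [Real.log_pow, Real.log_pow, ← mul_sub, ← Real.log_div (by positivity) hℓ0.ne']
        have : (ℓ + T) / ℓ = 1 + T / ℓ := by field_simp
        rw [this]; ring

end QuadraticForms

/-! ### Geometric medians -/

/-- Compare the objective at `m` and at `z₀`. The triangle inequality is used in opposite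
directions: on `S` the distance to `m` is at least `‖m - z₀‖ - ρ`, off `S` it is at least `‖z₀ - z
i‖ - ‖m - z₀‖`. The unknown distances off `S` cancel, leaving `(1 - 2a)‖m - z₀‖ ≤ (2 - 2a)ρ`. -/
theorem IsGeometricMedian.norm_sub_le {V : Type*} [SeminormedAddCommGroup V] {N : ℕ}
    {z : Fin N → V} {m : V} (h : IsGeometricMedian z m) (hN : 0 < N) (S : Finset (Fin N))
    (z₀ : V) {ρ : ℝ} (hρ : ∀ i ∈ S, ‖z i - z₀‖ ≤ ρ) {a : ℝ} (ha : a < 1 / 2)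
    (hS : (Sᶜ.card : ℝ) = a * N) :
    ‖m - z₀‖ ≤ (2 - 2 * a) / (1 - 2 * a) * ρ := by
  have hN' : (0 : ℝ) < N := by exact_mod_cast hN
  have h0 := le_of_mul_le_mul_left (h z₀) (by positivity)
  rw [← Finset.sum_add_sum_compl S, ← Finset.sum_add_sum_compl S] at h0
  have h1 : ∑ i ∈ S, (‖m - z₀‖ - ‖z i - z₀‖) ≤ ∑ i ∈ S, ‖m - z i‖ :=
    Finset.sum_le_sum fun i _ => by
      have := norm_sub_le_norm_sub_add_norm_sub m (z i) z₀
      linarith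
  have h2 : ∑ i ∈ Sᶜ, (‖z₀ - z i‖ - ‖m - z₀‖) ≤ ∑ i ∈ Sᶜ, ‖m - z i‖ :=
    Finset.sum_le_sum fun i _ => by
      have := norm_sub_le_norm_sub_add_norm_sub z₀ m (z i)
      rw [norm_sub_rev z₀ m] at this
      linarith
  have h3 : ∑ i ∈ S, ‖z i - z₀‖ ≤ S.card * ρ := by
    simpa using Finset.sum_le_sum hρ
  simp only [Finset.sum_sub_distrib, Finset.sum_const, nsmul_eq_mul] at h1 h2
  have h4 : ∑ i ∈ S, ‖z₀ - z i‖ = ∑ i ∈ S, ‖z i - z₀‖ :=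
    Finset.sum_congr rfl fun i _ => norm_sub_rev _ _
  have hcard : (S.card : ℝ) = (1 - a) * N := by
    have := Finset.card_add_card_compl S
    rw [Fintype.card_fin] at this
    have h5 : (S.card : ℝ) + Sᶜ.card = N := by exact_mod_cast this
    linarith
  rw [hS] at h2
  rw [hcard] at h1 h3
  have h6 : (1 - 2 * a) * ‖m - z₀‖ * N ≤ (2 - 2 * a) * ρ * N := by linarith
  have h7 := le_of_mul_le_mul_right h6 hN'
  rw [div_mul_eq_mul_div, le_div_iff₀ (by linarith)]
  linarith

/-- Otherwise the symmetric part of `m` would be strictly closer to every symmetric `z i`. This is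
the purpose of the server's symmetry check, and it makes `Λ` symmetric whatever the attacker sends.
-/
theorem IsGeometricMedian.isSymm {d N : ℕ} {z : Fin N → Mat d} {m : Mat d}
    (h : IsGeometricMedian z m) (hN : 0 < N) (hz : ∀ i, (z i).IsSymm) : m.IsSymm := by
  by_contra hm
  have hpos : 0 < ‖(2⁻¹ : ℝ) • (m - mᵀ)‖ := by
    rw [norm_pos_iff, smul_ne_zero_iff]
    exact ⟨by norm_num, fun h => hm (sub_eq_zero.1 h).symm⟩
  have hN' : (0 : ℝ) < N := by exact_mod_cast hN
  have h0 := le_of_mul_le_mul_left (h ((2⁻¹ : ℝ) • (m + mᵀ))) (by positivity)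
  revert h0
  refine imp_false.2 (not_le.2 ?_)
  refine Finset.sum_lt_sum_of_nonempty ?_ fun i _ => ?_
  · have := Fin.pos_iff_nonempty.1 hN
    exact Finset.univ_nonempty
  · have := frobenius_norm_symmetrization_sq m (z i) (hz i)
    refine lt_of_pow_lt_pow_left₀ 2 (norm_nonneg _) ?_
    have := pow_pos hpos 2
    linarith

/-! ### Confidence ellipsoids -/

section Ellipsoid

variable {d : ℕ}

theorem inner_eq_dotProduct (x y : Vec d) : (inner ℝ x y : ℝ) = x.ofLp ⬝ᵥ y.ofLp := by
  rw [EuclideanSpace.inner_eq_star_dotProduct, star_trivial, dotProduct_comm]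

theorem wnorm_sq {A : Mat d} (hA : A.PosSemidef) (x : Vec d) :
    wnorm A x ^ 2 = x.ofLp ⬝ᵥ (A *ᵥ x.ofLp) := by
  rw [wnorm, Real.sq_sqrt]
  simpa using hA.dotProduct_mulVec_nonneg x.ofLp

theorem add_smul_one_form_ge {G H : Mat d} {lam : ℝ} (hGH : ‖G - H‖ ≤ lam / 4)
    (y : Fin d → ℝ) :
    y ⬝ᵥ (H *ᵥ y) + 3 / 4 * lam * (y ⬝ᵥ y) ≤ y ⬝ᵥ ((G + lam • (1 : Mat d)) *ᵥ y) := by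
  have h1 := abs_form_le_frobenius (G - H) y
  have h2 : (0 : ℝ) ≤ y ⬝ᵥ y := by simpa using dotProduct_star_self_nonneg y
  have h3 := mul_le_mul_of_nonneg_right hGH h2
  have h4 := (abs_le.1 h1).1
  rw [Matrix.sub_mulVec, dotProduct_sub] at h4
  rw [Matrix.add_mulVec, Matrix.smul_mulVec, Matrix.one_mulVec, dotProduct_add, dotProduct_smul,
    smul_eq_mul]
  linarith

/-- The error is `x·Λ⁻¹z` with `z = b - Λθ* = (b - Hθ*) - (G - H)θ* - λθ*`, whence `‖z‖ ≤ q + (1/4 +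
1)λs`. Cauchy–Schwarz in `Λ⁻¹` separates `x` from `z`. -/
theorem abs_inner_sub_le_of_confidence {G H : Mat d} {lam : ℝ} (hlam : 0 < lam) (hG : G.IsSymm)
    (hH : H.PosSemidef) (hGH : ‖G - H‖ ≤ lam / 4) (b θs : Vec d) {s q : ℝ} (hs : ‖θs‖ ≤ s)
    (hq : ‖b - WithLp.toLp 2 (H *ᵥ θs.ofLp)‖ ≤ q) (x : Vec d) :
    |inner ℝ x (WithLp.toLp 2 ((G + lam • (1 : Mat d))⁻¹ *ᵥ b.ofLp)) - inner ℝ x θs|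
      ≤ wnorm (G + lam • (1 : Mat d))⁻¹ x * (2 * (5 / 4 * lam * s + q) / √lam) := by
  set Λ : Mat d := G + lam • (1 : Mat d) with hΛ
  have hyy : ∀ y : Fin d → ℝ, (0 : ℝ) ≤ y ⬝ᵥ y := fun y => by
    simpa using dotProduct_star_self_nonneg y
  -- The constant `3/4` is available; `1/4` is kept because `√(4/λ)` is then the factor `2/√λ` of
  -- the bound.
  have hlow : ∀ y, lam / 4 * (y ⬝ᵥ y) ≤ y ⬝ᵥ (Λ *ᵥ y) := fun y => by
    have h1 := add_smul_one_form_ge hGH y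
    have h2 := hH.dotProduct_mulVec_nonneg y
    rw [star_trivial] at h2
    have := mul_nonneg hlam.le (hyy y)
    linarith
  have hsymm : Λ.IsSymm := hG.add (Matrix.isSymm_one.smul lam)
  have hpd : Λ.PosDef := posDef_of_le_form hsymm (by positivity) hlow
  have hinv := hpd.inv.posSemidef
  set z : Fin d → ℝ := b.ofLp - Λ *ᵥ θs.ofLp with hz
  have hdiff : inner ℝ x (WithLp.toLp 2 (Λ⁻¹ *ᵥ b.ofLp)) - inner ℝ x θs
      = x.ofLp ⬝ᵥ (Λ⁻¹ *ᵥ z) := by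
    rw [inner_eq_dotProduct, inner_eq_dotProduct, hz, Matrix.mulVec_sub, Matrix.mulVec_mulVec,
      Matrix.nonsing_inv_mul _ hpd.det_pos.ne'.isUnit, Matrix.one_mulVec, dotProduct_sub]
  have hznorm : ‖WithLp.toLp 2 z‖ ≤ 5 / 4 * lam * s + q := by
    have hzdec : WithLp.toLp 2 z = (b - WithLp.toLp 2 (H *ᵥ θs.ofLp))
        - WithLp.toLp 2 ((G - H) *ᵥ θs.ofLp) - lam • θs := by
      ext i
      simp [hz, hΛ, Matrix.add_mulVec, Matrix.sub_mulVec, Matrix.smul_mulVec]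
      ring
    rw [hzdec]
    refine (norm_sub_le _ _).trans ?_
    have h1 := norm_sub_le (b - WithLp.toLp 2 (H *ᵥ θs.ofLp))
      (WithLp.toLp 2 ((G - H) *ᵥ θs.ofLp))
    have h2 : ‖WithLp.toLp 2 ((G - H) *ᵥ θs.ofLp)‖ ≤ lam / 4 * s :=
      (norm_toLp_mulVec_le (G - H) θs.ofLp).trans
        (mul_le_mul hGH hs (norm_nonneg _) (by positivity))
    have h3 : ‖lam • θs‖ ≤ lam * s := by
      rw [norm_smul, Real.norm_eq_abs, abs_of_pos hlam]
      gcongr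
    linarith
  have hzw : z ⬝ᵥ (Λ⁻¹ *ᵥ z) ≤ (2 * (5 / 4 * lam * s + q) / √lam) ^ 2 := by
    refine (dotProduct_inv_mulVec_le hpd (by positivity) hlow z).trans ?_
    rw [dotProduct_self_eq_norm_sq, div_pow, Real.sq_sqrt hlam.le, mul_pow, div_div_eq_mul_div]
    have : ‖WithLp.toLp 2 z‖ ^ 2 ≤ (5 / 4 * lam * s + q) ^ 2 := by gcongr
    rw [div_le_div_iff_of_pos_right hlam]
    linarith
  have hnn : 0 ≤ 2 * (5 / 4 * lam * s + q) / √lam := by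
    have := (norm_nonneg _).trans hznorm
    positivity
  rw [hdiff]
  refine abs_le_of_sq_le_sq ?_ (mul_nonneg (Real.sqrt_nonneg _) hnn)
  refine (dotProduct_mulVec_sq_le hinv x.ofLp z).trans ?_
  rw [mul_pow, wnorm_sq hinv]
  have h0 := hinv.dotProduct_mulVec_nonneg x.ofLp
  rw [star_trivial] at h0
  gcongr

/-- Optimism: the index of `y` exceeds its true value, and the index of `x` exceeds its own by at
most twice the width at `x`. -/
theorem inner_le_add_of_ucb_le {Λ : Mat d} {θ θs : Vec d} {β : ℝ}
    (hconf : ∀ x : Vec d, |inner ℝ x θ - inner ℝ x θs| ≤ wnorm Λ⁻¹ x * β) {x y : Vec d}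
    (h : ucb β θ Λ y ≤ ucb β θ Λ x) :
    (inner ℝ y θs : ℝ) - inner ℝ x θs ≤ 2 * β * wnorm Λ⁻¹ x := by
  have h1 := (abs_le.1 (hconf x)).2
  have h2 := (abs_le.1 (hconf y)).1
  simp only [ucb] at h
  linarith

end Ellipsoid

/-! ### Parameters -/

section Parameters

theorem reg_pos {L : ℕ} (hL : 0 < L) (ι C σ : ℝ) (k : ℕ) : 0 < reg L ι C σ k :=
  lt_of_lt_of_le (by exact_mod_cast hL) (le_max_left _ _)

theorem sqrt_two_mul_le {a : ℝ} : √(2 * a) ≤ 3 / 2 * √a := by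
  rw [Real.sqrt_mul zero_le_two]
  have : √2 ≤ 3 / 2 := by
    rw [Real.sqrt_le_left (by norm_num)]; norm_num
  gcongr

theorem mul_sqrt_le_reg (L : ℕ) {ι C σ : ℝ} (hι : 0 ≤ ι) (hC : 0 ≤ C) (hσ : 0 ≤ σ) (k : ℕ) :
    8 * (C * σ * √((k * L : ℕ) * ι)) ≤ reg L ι C σ k := by
  refine le_trans ?_ (le_max_right _ _)
  have h1 : √((k * L : ℕ) * ι) ≤ √(L * ι) * √((k : ℝ) + 1) := by
    rw [← Real.sqrt_mul (by positivity)]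
    refine Real.sqrt_le_sqrt ?_
    push_cast
    have : 0 ≤ (L : ℝ) * ι := by positivity
    nlinarith
  have h2 := mul_le_mul_of_nonneg_left h1 (mul_nonneg hC hσ)
  linarith

theorem sqrt_variance_le {n : ℕ} {σ ι : ℝ} (hσ : 0 ≤ σ) :
    √(2 * (n * σ ^ 2) * ι) ≤ 3 / 2 * (σ * √(n * ι)) := by
  have : 2 * (n * σ ^ 2) * ι = 2 * (σ ^ 2 * (n * ι)) := by ring
  rw [this]
  refine sqrt_two_mul_le.trans ?_
  rw [Real.sqrt_mul (sq_nonneg σ), Real.sqrt_sq hσ]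

/-- This fixes the constant `8` in `reg`: the error of the median is at most `3/2` of a quantity
that `reg` dominates eightfold. -/
theorem calpha_mul_deviation_le_reg (L : ℕ) {ι C σ : ℝ} (hι : 0 ≤ ι) (hC : 0 ≤ C) (hσ : 0 ≤ σ)
    (k : ℕ) : C * √(2 * ((k * L : ℕ) * σ ^ 2) * ι) ≤ reg L ι C σ k / 4 := by
  have h1 := mul_le_mul_of_nonneg_left (sqrt_variance_le (n := k * L) (ι := ι) hσ) hC
  have h2 := mul_sqrt_le_reg L hι hC hσ k
  have : 0 ≤ C * σ * √((k * L : ℕ) * ι) := by positivity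
  linarith

/-- The constants `3` and `4` of `conf` cover `2 · 5/4` and `2 · 3/2`. The noise part acquires its
factor `√d` from `√d ≥ 1`, and the last summand of `conf` is spare. -/
theorem confidence_radius_le_conf {d : ℕ} (hd : 0 < d) (N : ℕ) {L : ℕ} (hL : 0 < L)
    {ι C σ R : ℝ} (hι : 0 ≤ ι) (hC : 0 ≤ C) (hσ : 0 ≤ σ) (hR : 0 ≤ R) (k : ℕ) :
    2 * (5 / 4 * reg L ι C σ k * √d + C * (√(2 * ((k * L : ℕ) * σ ^ 2) * ι) * √d
      + √(2 * ((k * L : ℕ) * R ^ 2) * ι))) / √(reg L ι C σ k) ≤ conf d N L ι C σ R k := by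
  have hlam := reg_pos hL ι C σ k
  rw [conf]
  set lam := reg L ι C σ k
  have hd1 : (1 : ℝ) ≤ √d := by
    rw [Real.one_le_sqrt]; exact_mod_cast hd
  set u := √((k * L : ℕ) * ι) with hu
  have h1 := sqrt_variance_le (n := k * L) (ι := ι) hσ
  have h2 := sqrt_variance_le (n := k * L) (ι := ι) hR
  have hu0 : 0 ≤ u := Real.sqrt_nonneg _
  have h3 : √((k : ℝ) * L * d * ι) = u * √d := by
    rw [hu, ← Real.sqrt_mul (by positivity)]; push_cast; congr 1; ring
  have h4 : √(lam * d) = √lam * √d := Real.sqrt_mul hlam.le _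
  have hsl : 0 < √lam := Real.sqrt_pos.2 hlam
  have hll : lam = √lam * √lam := (Real.mul_self_sqrt hlam.le).symm
  have h5 : 0 ≤ 2 * R * √(d * ι / N) := by positivity
  rw [h3, h4, div_le_iff₀ hsl, add_mul, add_mul, div_mul_cancel₀ _ hsl.ne']
  have h6 : 0 ≤ 2 * R * √(d * ι / N) * √lam := by positivity
  have h7 : 3 * (√lam * √d) * √lam = 3 * (lam * √d) := by
    rw [mul_comm √lam √d, mul_assoc, mul_assoc, ← hll]; ring
  rw [h7]
  have h8 : C * (√(2 * ((k * L : ℕ) * σ ^ 2) * ι) * √d + √(2 * ((k * L : ℕ) * R ^ 2) * ι))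
      ≤ C * (3 / 2 * (σ * u) * √d + 3 / 2 * (R * u) * √d) := by
    refine mul_le_mul_of_nonneg_left (add_le_add (by gcongr) (h2.trans ?_)) hC
    exact le_mul_of_one_le_right (by positivity) hd1
  have h9 : 0 ≤ lam * √d := by positivity
  have h10 : 0 ≤ u * √d * C * (σ + R) := by positivity
  linarith

end Parameters

/-! ### Regret on the event of concentration -/

section Deterministic

variable {Ω : Type*} {d N : ℕ}

/-- Deviation of the Gram matrix of agent `i`, over the steps before `n` at which it is not
corrupted, from the sum of the means `M`. -/
noncomputable def gramDev (r : Run Ω d N) (e : Env Ω d N) (M : ℕ → Ω → Mat d) (i : Fin N) (n : ℕ)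
    (ω : Ω) : Mat d :=
  ∑ s ∈ Finset.range n, if i ∈ e.reliable s then outer (r.x s i ω) - M s ω else 0

/-- The accumulated noise of agent `i` over the steps before `n` at which it is not corrupted. -/
noncomputable def noiseSum (r : Run Ω d N) (e : Env Ω d N) (i : Fin N) (n : ℕ) (ω : Ω) : Vec d :=
  ∑ s ∈ Finset.range n, if i ∈ e.reliable s then e.η s i ω • r.x s i ω else 0

/-- The concentration event: at the start of each episode, the Gram matrix and the accumulated
noise of each agent are close to their means. -/
structure Concentrated (r : Run Ω d N) (e : Env Ω d N) (M : ℕ → Ω → Mat d) (T L : ℕ)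
    (ι σ R : ℝ) (ω : Ω) : Prop where
  posSemidef : ∀ s < T, (M s ω).PosSemidef
  gram : ∀ k, k * L < T → ∀ i,
    ‖gramDev r e M i (k * L) ω‖ ≤ √(2 * ((k * L : ℕ) * σ ^ 2) * ι)
  noise : ∀ k, k * L < T → ∀ i,
    ‖noiseSum r e i (k * L) ω‖ ≤ √(2 * ((k * L : ℕ) * R ^ 2) * ι)

theorem outer_isSymm (x : Vec d) : (outer x).IsSymm := Matrix.transpose_vecMulVec _ _

theorem outer_mulVec (x y : Vec d) : outer x *ᵥ y.ofLp = ((inner ℝ x y : ℝ) • x).ofLp := by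
  rw [outer, Matrix.vecMulVec_mulVec, op_smul_eq_smul, inner_eq_dotProduct]
  rfl

theorem sum_range_mul_eq {A : Type*} [AddCommMonoid A] (f : ℕ → A) (L k : ℕ) :
    ∑ j ∈ Finset.range k, ∑ t ∈ Finset.Ico (j * L) ((j + 1) * L), f t
      = ∑ t ∈ Finset.range (k * L), f t := by
  induction k with
  | zero => simp
  | succ k ih =>
    rw [Finset.sum_range_succ, ih, Finset.range_eq_Ico, Finset.range_eq_Ico,
      Finset.sum_Ico_consecutive _ (Nat.zero_le _) (Nat.mul_le_mul_right L (Nat.le_succ k))]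

theorem mem_reliable_of_notMem_corrupted {e : Env Ω d N} {T t : ℕ} (ht : t < T) {i : Fin N}
    (hi : i ∈ (e.corrupted T)ᶜ) : i ∈ e.reliable t := by
  by_contra h
  refine Finset.mem_compl.1 hi (Finset.mem_biUnion.2 ⟨t, Finset.mem_range.2 ht, ?_⟩)
  exact Finset.mem_compl.2 h

variable {T L : ℕ}
  {R σ ι : ℝ} {e : Env Ω d N} {r : Run Ω d N} {lam : ℕ → ℝ}
  {pick : ℕ → Vec d → Mat d → DecisionSet d → Vec d} {M : ℕ → Ω → Mat d}

theorem Run.checkedU_isSymm (r : Run Ω d N) (k : ℕ) (i : Fin N) (ω : Ω) :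
    (r.checkedU k i ω).IsSymm := by
  rw [Run.checkedU]
  split_ifs with h
  · exact h
  · exact Matrix.isSymm_zero

theorem isSymm_sum {ι' : Type*} (s : Finset ι') (f : ι' → Mat d) (h : ∀ i ∈ s, (f i).IsSymm) :
    (∑ i ∈ s, f i).IsSymm := by
  rw [Matrix.IsSymm, Matrix.transpose_sum]
  exact Finset.sum_congr rfl h

theorem Run.V_isSymm (r : Run Ω d N) (k : ℕ) (i : Fin N) (ω : Ω) : (r.V k i ω).IsSymm :=
  isSymm_sum _ _ fun j _ => r.checkedU_isSymm j i ω

theorem card_compl_compl_corrupted (hN : 0 < N) (e : Env Ω d N) (T : ℕ) :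
    (((e.corrupted T)ᶜ)ᶜ.card : ℝ) = e.alpha T * N := by
  have : (N : ℝ) ≠ 0 := by exact_mod_cast hN.ne'
  rw [compl_compl, Env.alpha, div_mul_cancel₀ _ this]

theorem one_le_calpha {a : ℝ} (ha : a < 1 / 2) : 1 ≤ (2 - 2 * a) / (1 - 2 * a) := by
  rw [le_div_iff₀ (by linarith)]
  linarith

theorem Env.one_le_Calpha (e : Env Ω d N) (hα : e.alpha T < 1 / 2) : 1 ≤ e.Calpha T :=
  one_le_calpha hα

theorem Concentrated.posSemidef_sum {ω : Ω} (hc : Concentrated r e M T L ι σ R ω) {n : ℕ}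
    (hn : n < T) : (∑ s ∈ Finset.range n, M s ω).PosSemidef :=
  Matrix.posSemidef_sum _ fun s hs => hc.posSemidef s ((Finset.mem_range.1 hs).trans hn)

/-- The actions of agent `i` at the steps before `T` at which it is not corrupted, padded by
zero. -/
noncomputable def paddedAction (r : Run Ω d N) (e : Env Ω d N) (T : ℕ) (i : Fin N) (ω : Ω) (t : ℕ) :
    Fin d → ℝ :=
  if t < T ∧ i ∈ e.reliable t then (r.x t i ω).ofLp else 0

theorem paddedAction_dotProduct_le (hx : ∀ t < T, ∀ i ∈ e.reliable t, ∀ ω, ‖r.x t i ω‖ ≤ 1)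
    (i : Fin N) (ω : Ω) (t : ℕ) :
    paddedAction r e T i ω t ⬝ᵥ paddedAction r e T i ω t ≤ 1 := by
  rw [paddedAction]
  split_ifs with h
  · rw [dotProduct_self_eq_norm_sq]
    exact pow_le_one₀ (norm_nonneg _) (hx t h.1 i h.2 ω)
  · simp

/-- Valid also for agents corrupted at some steps: such a step contributes nothing to the left side,
while its mean, being positive semidefinite, only enlarges the right side. Agents corrupted later
still count in the regret, so this case matters. -/
theorem form_sum_paddedAction_le {ω : Ω} (hc : Concentrated r e M T L ι σ R ω) {k : ℕ}
    (hk : k * L < T) (i : Fin N) (y : Fin d → ℝ) :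
    ∑ s ∈ Finset.range (k * L), (paddedAction r e T i ω s ⬝ᵥ y) ^ 2
      ≤ √(2 * ((k * L : ℕ) * σ ^ 2) * ι) * (y ⬝ᵥ y)
        + y ⬝ᵥ ((∑ s ∈ Finset.range (k * L), M s ω) *ᵥ y) := by
  have hyy : (0 : ℝ) ≤ y ⬝ᵥ y := by simpa using dotProduct_star_self_nonneg y
  have h1 : y ⬝ᵥ (gramDev r e M i (k * L) ω *ᵥ y)
      ≤ √(2 * ((k * L : ℕ) * σ ^ 2) * ι) * (y ⬝ᵥ y) :=
    (le_abs_self _).trans ((abs_form_le_frobenius _ y).trans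
      (mul_le_mul_of_nonneg_right (hc.gram k hk i) hyy))
  have h2 : ∑ s ∈ Finset.range (k * L), (paddedAction r e T i ω s ⬝ᵥ y) ^ 2
      ≤ y ⬝ᵥ (gramDev r e M i (k * L) ω *ᵥ y)
        + y ⬝ᵥ ((∑ s ∈ Finset.range (k * L), M s ω) *ᵥ y) := by
    rw [gramDev, Matrix.sum_mulVec, Matrix.sum_mulVec, dotProduct_sum, dotProduct_sum,
      ← Finset.sum_add_distrib]
    refine Finset.sum_le_sum fun s hs => ?_
    have hsT : s < T := (Finset.mem_range.1 hs).trans hk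
    by_cases hi : i ∈ e.reliable s
    · rw [paddedAction, if_pos ⟨hsT, hi⟩, if_pos hi, Matrix.sub_mulVec, dotProduct_sub, outer,
        form_vecMulVec_self]
      linarith
    · have h3 := (hc.posSemidef s hsT).dotProduct_mulVec_nonneg y
      rw [star_trivial] at h3
      rw [paddedAction, if_neg (fun h => hi h.2), if_neg hi]
      simpa using h3
  linarith

theorem sSup_inner_sub_le (D : DecisionSet d) (θ x : Vec d) {B : ℝ}
    (h : ∀ y ∈ D, (inner ℝ y θ : ℝ) - inner ℝ x θ ≤ B) :
    sSup ((fun y : Vec d => (inner ℝ y θ : ℝ)) '' (D : Set (Vec d))) - inner ℝ x θ ≤ B := by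
  rw [sub_le_iff_le_add]
  refine csSup_le (D.nonempty.image _) ?_
  rintro _ ⟨y, hy, rfl⟩
  have := h y hy
  linarith

theorem Run.regret_le_sum (e : Env Ω d N) (r : Run Ω d N) (T : ℕ) (ω : Ω) (B : ℕ → Fin N → ℝ)
    (h : ∀ t < T, ∀ i ∈ e.reliable t, ∀ y ∈ e.D t i ω,
      (inner ℝ y e.θstar : ℝ) - inner ℝ (r.x t i ω) e.θstar ≤ B t i) :
    r.regret e T ω ≤ ∑ i, ∑ t ∈ (Finset.range T).filter (fun t => i ∈ e.reliable t), B t i := by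
  have hcomm : ∑ t ∈ Finset.range T, ∑ i ∈ e.reliable t, B t i
      = ∑ i, ∑ t ∈ (Finset.range T).filter (fun t => i ∈ e.reliable t), B t i := by
    refine Finset.sum_comm' fun t i => ?_
    simp
  rw [← hcomm, Run.regret]
  exact Finset.sum_le_sum fun t ht => Finset.sum_le_sum fun i hi =>
    sSup_inner_sub_le _ _ _ (h t (Finset.mem_range.1 ht) i hi)

variable [mΩ : MeasurableSpace Ω] {μ : Measure Ω} {ℱ : Filtration ℕ mΩ}

theorem Run.IsExecution.msgU_isSymm (hr : r.IsExecution e ℱ T L lam pick) {j : ℕ}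
    (hj : (j + 1) * L ≤ T) {i : Fin N} (hi : i ∈ (e.corrupted T)ᶜ) (ω : Ω) :
    (r.msgU j i ω).IsSymm := by
  rw [hr.honest_U j hj i (fun t ht => mem_reliable_of_notMem_corrupted
    ((Finset.mem_Ico.1 ht).2.trans_le hj) hi)]
  exact isSymm_sum _ _ fun t _ => outer_isSymm _

theorem Run.IsExecution.V_eq (hr : r.IsExecution e ℱ T L lam pick) {k : ℕ} (hk : k * L < T)
    {i : Fin N} (hi : i ∈ (e.corrupted T)ᶜ) (ω : Ω) :
    r.V k i ω = ∑ s ∈ Finset.range (k * L), outer (r.x s i ω) := by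
  rw [Run.V, ← sum_range_mul_eq]
  refine Finset.sum_congr rfl fun j hj => ?_
  have hjT : (j + 1) * L ≤ T :=
    (Nat.mul_le_mul_right L (Finset.mem_range.1 hj)).trans hk.le
  rw [Run.checkedU, if_pos (hr.msgU_isSymm hjT hi ω),
    hr.honest_U j hjT i (fun t ht => mem_reliable_of_notMem_corrupted
      ((Finset.mem_Ico.1 ht).2.trans_le hjT) hi)]

theorem Run.IsExecution.v_eq (hr : r.IsExecution e ℱ T L lam pick) {k : ℕ} (hk : k * L < T)
    {i : Fin N} (hi : i ∈ (e.corrupted T)ᶜ) (ω : Ω) :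
    r.v k i ω = ∑ s ∈ Finset.range (k * L), r.reward e s i ω • r.x s i ω := by
  rw [Run.v, ← sum_range_mul_eq]
  refine Finset.sum_congr rfl fun j hj => ?_
  have hjT : (j + 1) * L ≤ T :=
    (Nat.mul_le_mul_right L (Finset.mem_range.1 hj)).trans hk.le
  rw [Run.checkedu, if_pos (hr.msgU_isSymm hjT hi ω),
    hr.honest_u j hjT i (fun t ht => mem_reliable_of_notMem_corrupted
      ((Finset.mem_Ico.1 ht).2.trans_le hjT) hi)]

theorem Run.IsExecution.norm_G_sub_le (hr : r.IsExecution e ℱ T L lam pick) (hN : 0 < N)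
    (hα : e.alpha T < 1 / 2) {ω : Ω} (hc : Concentrated r e M T L ι σ R ω) {k : ℕ}
    (hk : k * L < T) :
    ‖r.G k ω - ∑ s ∈ Finset.range (k * L), M s ω‖
      ≤ e.Calpha T * √(2 * ((k * L : ℕ) * σ ^ 2) * ι) := by
  refine (hr.median_G k hk ω).norm_sub_le hN ((e.corrupted T)ᶜ) _ (fun i hi => ?_) hα
    (card_compl_compl_corrupted hN e T)
  refine le_of_eq_of_le ?_ (hc.gram k hk i)
  rw [hr.V_eq hk hi, gramDev, ← Finset.sum_sub_distrib]
  congr 1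
  refine Finset.sum_congr rfl fun s hs => ?_
  rw [if_pos (mem_reliable_of_notMem_corrupted ((Finset.mem_range.1 hs).trans hk) hi)]

theorem Run.IsExecution.norm_b_sub_le (hr : r.IsExecution e ℱ T L lam pick) (hN : 0 < N)
    (hα : e.alpha T < 1 / 2) (hθ : ‖e.θstar‖ ≤ √(d : ℝ)) {ω : Ω}
    (hc : Concentrated r e M T L ι σ R ω) {k : ℕ} (hk : k * L < T) :
    ‖r.b k ω - WithLp.toLp 2 ((∑ s ∈ Finset.range (k * L), M s ω) *ᵥ e.θstar.ofLp)‖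
      ≤ e.Calpha T * (√(2 * ((k * L : ℕ) * σ ^ 2) * ι) * √d
        + √(2 * ((k * L : ℕ) * R ^ 2) * ι)) := by
  refine (hr.median_b k hk ω).norm_sub_le hN ((e.corrupted T)ᶜ) _ (fun i hi => ?_) hα
    (card_compl_compl_corrupted hN e T)
  have hrel : ∀ s ∈ Finset.range (k * L), i ∈ e.reliable s := fun s hs =>
    mem_reliable_of_notMem_corrupted ((Finset.mem_range.1 hs).trans hk) hi
  -- Inserting the reward model splits the error into the Gram deviation applied to `θ*` and the
  -- accumulated noise.
  have hdec : r.v k i ω - WithLp.toLp 2 ((∑ s ∈ Finset.range (k * L), M s ω) *ᵥ e.θstar.ofLp)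
      = WithLp.toLp 2 (gramDev r e M i (k * L) ω *ᵥ e.θstar.ofLp)
        + noiseSum r e i (k * L) ω := by
    have hg : gramDev r e M i (k * L) ω = ∑ s ∈ Finset.range (k * L), outer (r.x s i ω)
        - ∑ s ∈ Finset.range (k * L), M s ω := by
      rw [gramDev, ← Finset.sum_sub_distrib]
      exact Finset.sum_congr rfl fun s hs => if_pos (hrel s hs)
    have hn : noiseSum r e i (k * L) ω
        = ∑ s ∈ Finset.range (k * L), e.η s i ω • r.x s i ω :=
      Finset.sum_congr rfl fun s hs => if_pos (hrel s hs)
    have ho : WithLp.toLp 2 ((∑ s ∈ Finset.range (k * L), outer (r.x s i ω)) *ᵥ e.θstar.ofLp)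
        = ∑ s ∈ Finset.range (k * L), (inner ℝ (r.x s i ω) e.θstar : ℝ) • r.x s i ω := by
      rw [Matrix.sum_mulVec]
      simp only [outer_mulVec]
      rw [← WithLp.ofLp_sum]
    rw [hr.v_eq hk hi, hg, hn, Matrix.sub_mulVec, WithLp.toLp_sub, ho]
    simp only [Run.reward, add_smul, Finset.sum_add_distrib]
    abel
  rw [hdec]
  refine (norm_add_le _ _).trans (add_le_add ((norm_toLp_mulVec_le _ _).trans ?_)
    (hc.noise k hk i))
  exact mul_le_mul (hc.gram k hk i) hθ (norm_nonneg _) (Real.sqrt_nonneg _)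

theorem Run.IsExecution.norm_x_le_one (hr : r.IsExecution e ℱ T L lam pick)
    (he : e.Valid μ ℱ T R) {β : ℕ → ℝ} (hp : IsArgmaxRule β pick) {t : ℕ} (ht : t < T)
    {i : Fin N} (hi : i ∈ e.reliable t) (ω : Ω) : ‖r.x t i ω‖ ≤ 1 :=
  he.norm_le_one t ht i hi ω _ (by rw [hr.action t ht i hi ω]; exact hp.mem _ _ _ _)

/-- The server's stale aggregate controls each agent's current information. The steps before the
episode are compared with `H` at cost `λ/4`, and the at most `L ≤ λ` steps inside it cost `λ`. With
the regulariser `L ≤ λ`, a quarter of the total is at most `9/16 λ` plus a quarter of the form of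
`H`, below the available `3/4 λ` plus the form of `H`. -/
theorem Run.IsExecution.form_le (hr : r.IsExecution e ℱ T L (reg L ι (e.Calpha T) σ) pick)
    (hN : 0 < N) (hL : 0 < L) (hι : 0 ≤ ι) (hσ : 0 ≤ σ) (hα : e.alpha T < 1 / 2)
    (hx : ∀ t < T, ∀ i ∈ e.reliable t, ∀ ω, ‖r.x t i ω‖ ≤ 1)
    {ω : Ω} (hc : Concentrated r e M T L ι σ R ω) {t : ℕ} (ht : t < T) (i : Fin N)
    (y : Fin d → ℝ) :
    y ⬝ᵥ (((1 / 4 : ℝ) • ((L : ℝ) • (1 : Mat d) + ∑ s ∈ Finset.range t,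
        Matrix.vecMulVec (paddedAction r e T i ω s) (paddedAction r e T i ω s))) *ᵥ y)
      ≤ y ⬝ᵥ (r.Λ (reg L ι (e.Calpha T) σ) (t / L) ω *ᵥ y) := by
  set k := t / L with hk
  have hkt : k * L ≤ t := Nat.div_mul_le_self t L
  have hkT : k * L < T := hkt.trans_lt ht
  have htk : t ≤ k * L + L := by
    have := Nat.lt_div_mul_add (a := t) hL
    rw [← hk] at this
    omega
  have hC := e.one_le_Calpha hα
  have hyy : (0 : ℝ) ≤ y ⬝ᵥ y := by simpa using dotProduct_star_self_nonneg y
  set lam := reg L ι (e.Calpha T) σ k with hlam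
  have hLlam : (L : ℝ) ≤ lam := le_max_left _ _
  have hdev := calpha_mul_deviation_le_reg L hι (by linarith : 0 ≤ e.Calpha T) hσ k
  have hρ : √(2 * ((k * L : ℕ) * σ ^ 2) * ι) ≤ lam / 4 :=
    (le_mul_of_one_le_left (Real.sqrt_nonneg _) hC).trans hdev
  have hlow := add_smul_one_form_ge ((hr.norm_G_sub_le hN hα hc hkT).trans hdev) y
  have h1 := form_sum_paddedAction_le hc hkT i y
  have h2 : ∑ s ∈ Finset.Ico (k * L) t, (paddedAction r e T i ω s ⬝ᵥ y) ^ 2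
      ≤ L * (y ⬝ᵥ y) := by
    calc ∑ s ∈ Finset.Ico (k * L) t, (paddedAction r e T i ω s ⬝ᵥ y) ^ 2
        ≤ ∑ _s ∈ Finset.Ico (k * L) t, y ⬝ᵥ y := Finset.sum_le_sum fun s _ =>
          (sq_dotProduct_le _ _).trans
            (mul_le_of_le_one_left hyy (paddedAction_dotProduct_le hx i ω s))
      _ = ((t - k * L : ℕ) : ℝ) * (y ⬝ᵥ y) := by simp
      _ ≤ L * (y ⬝ᵥ y) := by
          gcongr
          omega
  have h3 : ∑ s ∈ Finset.range t, (paddedAction r e T i ω s ⬝ᵥ y) ^ 2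
      = ∑ s ∈ Finset.range (k * L), (paddedAction r e T i ω s ⬝ᵥ y) ^ 2
        + ∑ s ∈ Finset.Ico (k * L) t, (paddedAction r e T i ω s ⬝ᵥ y) ^ 2 :=
    (Finset.sum_range_add_sum_Ico _ hkt).symm
  have h4 := (hc.posSemidef_sum hkT).dotProduct_mulVec_nonneg y
  rw [star_trivial] at h4
  rw [Run.Λ, ← hlam]
  rw [← hlam] at hlow
  refine le_trans ?_ hlow
  rw [Matrix.smul_mulVec, Matrix.add_mulVec, Matrix.smul_mulVec, Matrix.one_mulVec,
    dotProduct_smul, dotProduct_add, dotProduct_smul, smul_eq_mul, smul_eq_mul,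
    Matrix.sum_mulVec, dotProduct_sum]
  simp only [form_vecMulVec_self]
  rw [h3]
  have h5 := mul_le_mul_of_nonneg_right hρ hyy
  have h6 := mul_le_mul_of_nonneg_right hLlam hyy
  have h7 : 0 ≤ lam * (y ⬝ᵥ y) := mul_nonneg ((Nat.cast_nonneg L).trans hLlam) hyy
  linarith

theorem Run.IsExecution.posDef_Λ (hr : r.IsExecution e ℱ T L (reg L ι (e.Calpha T) σ) pick)
    (hN : 0 < N) (hL : 0 < L) (hι : 0 ≤ ι) (hσ : 0 ≤ σ) (hα : e.alpha T < 1 / 2)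
    {ω : Ω} (hc : Concentrated r e M T L ι σ R ω) {k : ℕ} (hk : k * L < T) :
    (r.Λ (reg L ι (e.Calpha T) σ) k ω).PosDef := by
  have hC := e.one_le_Calpha hα
  have hG : (r.G k ω).IsSymm := (hr.median_G k hk ω).isSymm hN fun i => r.V_isSymm k i ω
  have hdev := calpha_mul_deviation_le_reg L hι (by linarith : 0 ≤ e.Calpha T) hσ k
  have hpos := reg_pos hL ι (e.Calpha T) σ k
  refine posDef_of_le_form (a := 3 / 4 * reg L ι (e.Calpha T) σ k)
    (hG.add (Matrix.isSymm_one.smul _)) (by positivity) fun y => ?_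
  have hlow := add_smul_one_form_ge ((hr.norm_G_sub_le hN hα hc hk).trans hdev) y
  have h4 := (hc.posSemidef_sum hk).dotProduct_mulVec_nonneg y
  rw [star_trivial] at h4
  exact le_trans (by linarith) hlow

/-- Inversion turns the domination by a quarter into a factor `4`, and the potential lemma
contributes `2`. -/
theorem Run.IsExecution.sum_wnorm_sq_le
    (hr : r.IsExecution e ℱ T L (reg L ι (e.Calpha T) σ) pick)
    (hN : 0 < N) (hL : 0 < L) (hι : 0 ≤ ι) (hσ : 0 ≤ σ) (hα : e.alpha T < 1 / 2)
    (hx : ∀ t < T, ∀ i ∈ e.reliable t, ∀ ω, ‖r.x t i ω‖ ≤ 1)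
    {ω : Ω} (hc : Concentrated r e M T L ι σ R ω) (i : Fin N) :
    ∑ t ∈ (Finset.range T).filter (fun t => i ∈ e.reliable t),
        wnorm (r.Λ (reg L ι (e.Calpha T) σ) (t / L) ω)⁻¹ (r.x t i ω) ^ 2
      ≤ 8 * d * Real.log (1 + T / L) := by
  have hL1 : (1 : ℝ) ≤ L := by exact_mod_cast hL
  have hpot := sum_dotProduct_inv_mulVec_le (paddedAction r e T i ω)
    (paddedAction_dotProduct_le hx i ω) hL1 T
  rw [Fintype.card_fin] at hpot
  set A : ℕ → Mat d := fun t => (L : ℝ) • (1 : Mat d) + ∑ s ∈ Finset.range t,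
    Matrix.vecMulVec (paddedAction r e T i ω s) (paddedAction r e T i ω s) with hA
  have hApd : ∀ t, (A t).PosDef := fun t => by
    refine (Matrix.PosDef.one.smul (by linarith : (0 : ℝ) < L)).add_posSemidef
      (Matrix.posSemidef_sum _ fun s _ => ?_)
    simpa using Matrix.posSemidef_vecMulVec_self_star (paddedAction r e T i ω s)
  have hterm : ∀ t < T, i ∈ e.reliable t →
      wnorm (r.Λ (reg L ι (e.Calpha T) σ) (t / L) ω)⁻¹ (r.x t i ω) ^ 2
        ≤ 4 * (paddedAction r e T i ω t ⬝ᵥ ((A t)⁻¹ *ᵥ paddedAction r e T i ω t)) := by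
    intro t ht hi
    have hpd := hr.posDef_Λ hN hL hι hσ hα hc ((Nat.div_mul_le_self t L).trans_lt ht)
    rw [wnorm_sq hpd.inv.posSemidef, paddedAction, if_pos ⟨ht, hi⟩]
    refine (dotProduct_inv_mulVec_anti hpd ((hApd t).smul (by norm_num : (0 : ℝ) < 1 / 4))
      (fun y => hr.form_le hN hL hι hσ hα hx hc ht i y) _).trans (le_of_eq ?_)
    have hinv : ((1 / 4 : ℝ) • A t)⁻¹ = (4 : ℝ) • (A t)⁻¹ := by
      refine Matrix.inv_eq_right_inv ?_
      rw [Matrix.smul_mul, Matrix.mul_smul, smul_smul,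
        Matrix.mul_nonsing_inv _ (hApd t).det_pos.ne'.isUnit]
      norm_num
    rw [hinv, Matrix.smul_mulVec, dotProduct_smul, smul_eq_mul]
  calc _ ≤ ∑ t ∈ (Finset.range T).filter (fun t => i ∈ e.reliable t),
        4 * (paddedAction r e T i ω t ⬝ᵥ ((A t)⁻¹ *ᵥ paddedAction r e T i ω t)) :=
        Finset.sum_le_sum fun t ht =>
          hterm t (Finset.mem_range.1 (Finset.mem_filter.1 ht).1) (Finset.mem_filter.1 ht).2
    _ ≤ ∑ t ∈ Finset.range T,
        4 * (paddedAction r e T i ω t ⬝ᵥ ((A t)⁻¹ *ᵥ paddedAction r e T i ω t)) := by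
        refine Finset.sum_le_sum_of_subset_of_nonneg (Finset.filter_subset _ _) fun t _ _ => ?_
        have := (hApd t).inv.posSemidef.dotProduct_mulVec_nonneg (paddedAction r e T i ω t)
        rw [star_trivial] at this
        positivity
    _ ≤ _ := by
        rw [← Finset.mul_sum]
        linarith

theorem Run.IsExecution.regret_le
    (hr : r.IsExecution e ℱ T L (reg L ι (e.Calpha T) σ) pick)
    (he : e.Valid μ ℱ T R)
    (hp : IsArgmaxRule (fun t => conf d N L ι (e.Calpha T) σ R (t / L)) pick)
    (hd : 0 < d) (hN : 0 < N) (hL : 0 < L) (hι : 0 ≤ ι) (hR : 0 ≤ R) (hσ : 0 ≤ σ)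
    (hα : e.alpha T < 1 / 2) (hlog : Real.log (1 + T / L) ≤ ι)
    {ω : Ω} (hc : Concentrated r e M T L ι σ R ω) {β : ℝ} (hβ0 : 0 ≤ β)
    (hβ : ∀ k, k * L < T → conf d N L ι (e.Calpha T) σ R k ≤ β) :
    r.regret e T ω ≤ 2 * β * (N * √(8 * (T * d * ι))) := by
  have hx : ∀ t < T, ∀ i ∈ e.reliable t, ∀ ω, ‖r.x t i ω‖ ≤ 1 := fun t ht i hi ω =>
    hr.norm_x_le_one he hp ht hi ω
  have hC := e.one_le_Calpha hα
  have hC0 : 0 ≤ e.Calpha T := by linarith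
  set w : ℕ → Fin N → ℝ := fun t i =>
    wnorm (r.Λ (reg L ι (e.Calpha T) σ) (t / L) ω)⁻¹ (r.x t i ω) with hw
  have hw0 : ∀ t i, 0 ≤ w t i := fun t i => Real.sqrt_nonneg _
  have hinst : ∀ t < T, ∀ i ∈ e.reliable t, ∀ y ∈ e.D t i ω,
      (inner ℝ y e.θstar : ℝ) - inner ℝ (r.x t i ω) e.θstar ≤ 2 * β * w t i := by
    intro t ht i hi y hy
    have hk : t / L * L < T := (Nat.div_mul_le_self t L).trans_lt ht
    have hG : (r.G (t / L) ω).IsSymm :=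
      (hr.median_G _ hk ω).isSymm hN fun i => r.V_isSymm _ i ω
    have hdev := calpha_mul_deviation_le_reg L hι hC0 hσ (t / L)
    -- The parameters were tuned so that `conf` dominates the radius of the ellipsoid; optimism then
    -- applies to the agent's choice.
    have hconf : ∀ x : Vec d,
        |inner ℝ x (r.θ (reg L ι (e.Calpha T) σ) (t / L) ω) - inner ℝ x e.θstar|
        ≤ wnorm (r.Λ (reg L ι (e.Calpha T) σ) (t / L) ω)⁻¹ x
          * conf d N L ι (e.Calpha T) σ R (t / L) := fun x =>
      (abs_inner_sub_le_of_confidence (reg_pos hL _ _ _ _) hG (hc.posSemidef_sum hk)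
        ((hr.norm_G_sub_le hN hα hc hk).trans hdev) (r.b (t / L) ω) e.θstar he.norm_θstar_le
        (hr.norm_b_sub_le hN hα he.norm_θstar_le hc hk) x).trans
      (mul_le_mul_of_nonneg_left (confidence_radius_le_conf hd N hL hι hC0 hσ hR _)
        (Real.sqrt_nonneg _))
    have hmax := hp.max t (r.θ (reg L ι (e.Calpha T) σ) (t / L) ω)
      (r.Λ (reg L ι (e.Calpha T) σ) (t / L) ω) (e.D t i ω) y hy
    rw [← hr.action t ht i hi ω] at hmax
    refine (inner_le_add_of_ucb_le hconf hmax).trans ?_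
    exact mul_le_mul_of_nonneg_right (by have := hβ _ hk; linarith) (hw0 t i)
  refine (r.regret_le_sum e T ω _ hinst).trans ?_
  have hagent : ∀ i, ∑ t ∈ (Finset.range T).filter (fun t => i ∈ e.reliable t), 2 * β * w t i
      ≤ 2 * β * √(8 * (T * d * ι)) := by
    intro i
    rw [← Finset.mul_sum]
    refine mul_le_mul_of_nonneg_left (Real.le_sqrt_of_sq_le ?_) (by positivity)
    -- Cauchy–Schwarz over the at most `T` steps at which agent `i` is uncorrupted.
    refine sq_sum_le_card_mul_sum_sq.trans ?_
    have h1 := hr.sum_wnorm_sq_le hN hL hι hσ hα hx hc i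
    have h2 : (((Finset.range T).filter (fun t => i ∈ e.reliable t)).card : ℝ) ≤ T := by
      exact_mod_cast (Finset.card_filter_le _ _).trans_eq (Finset.card_range T)
    calc _ ≤ (T : ℝ) * (8 * d * Real.log (1 + T / L)) :=
          mul_le_mul h2 h1 (Finset.sum_nonneg fun t _ => sq_nonneg _) (Nat.cast_nonneg T)
      _ ≤ T * (8 * d * ι) := by gcongr
      _ = _ := by ring
  refine (Finset.sum_le_sum fun i _ => hagent i).trans (le_of_eq ?_)
  simp only [Finset.sum_const, Finset.card_univ, Fintype.card_fin, nsmul_eq_mul]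
  ring

/-- Serves the case `L ≥ T`, in which the rate already exceeds this bound up to a constant. -/
theorem Run.IsExecution.regret_le_trivial (hr : r.IsExecution e ℱ T L lam pick)
    (he : e.Valid μ ℱ T R) {β : ℕ → ℝ} (hp : IsArgmaxRule β pick) (ω : Ω) :
    r.regret e T ω ≤ 2 * √d * N * T := by
  have hinner : ∀ x : Vec d, ‖x‖ ≤ 1 → |(inner ℝ x e.θstar : ℝ)| ≤ √d := fun x hx =>
    (abs_real_inner_le_norm x e.θstar).trans
      ((mul_le_of_le_one_left (norm_nonneg _) hx).trans he.norm_θstar_le)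
  refine (r.regret_le_sum e T ω (fun _ _ => 2 * √d) fun t ht i hi y hy => ?_).trans ?_
  · have h1 := (abs_le.1 (hinner y (he.norm_le_one t ht i hi ω y hy))).2
    have h2 := (abs_le.1 (hinner _ (hr.norm_x_le_one he hp ht hi ω))).1
    linarith
  · calc _ ≤ ∑ _i : Fin N, (T : ℝ) * (2 * √d) := by
          refine Finset.sum_le_sum fun i _ => ?_
          rw [Finset.sum_const, nsmul_eq_mul]
          gcongr
          exact (Finset.card_filter_le _ _).trans_eq (Finset.card_range T)
      _ = _ := by simp; ring

end Deterministic

/-! ### Measurability of matrix-valued maps -/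

section MatrixMeasurability

variable {α : Type*} {mα : MeasurableSpace α} {d : ℕ}

theorem measurable_mat_iff {f : α → Mat d} :
    Measurable f ↔ ∀ i j, Measurable fun ω => f ω i j :=
  (measurable_pi_iff (X := fun _ : Fin d => Fin d → ℝ) (g := f)).trans
    (forall_congr' fun _ => measurable_pi_iff)

theorem measurable_vec_iff {f : α → Vec d} :
    Measurable f ↔ ∀ i, Measurable fun ω => f ω i := by
  refine ⟨fun h i => ?_, fun h => ?_⟩
  · exact (measurable_pi_apply i).comp ((WithLp.measurable_ofLp 2 _).comp h)
  · exact (WithLp.measurable_toLp 2 _).comp (measurable_pi_iff.2 h)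

theorem measurable_det {f : α → Mat d} (hf : ∀ i j, Measurable fun ω => f ω i j) :
    Measurable fun ω => (f ω).det := by
  simp only [Matrix.det_apply']
  refine Finset.measurable_fun_sum _ fun σ _ => ?_
  exact (Finset.measurable_fun_prod _ fun i _ => hf _ _).const_mul _

/-- Entries of the inverse are polynomials in the entries times the inverse of the determinant, with
value `0` at singular matrices; invertibility is not needed. -/
theorem measurable_mat_inv {f : α → Mat d} (hf : Measurable f) :
    Measurable fun ω => (f ω)⁻¹ := by
  have hf' := measurable_mat_iff.1 hf
  refine measurable_mat_iff.2 fun i j => ?_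
  simp only [Matrix.inv_def, Matrix.smul_apply, Ring.inverse_eq_inv', smul_eq_mul,
    Matrix.adjugate_apply]
  refine (measurable_det hf').inv.mul (measurable_det fun k l => ?_)
  by_cases hk : k = j
  · subst hk
    simp [Matrix.updateRow_self]
  · simpa [Matrix.updateRow_ne hk] using hf' k l

theorem measurable_mulVec {f : α → Mat d} {g : α → Vec d} (hf : Measurable f)
    (hg : Measurable g) : Measurable fun ω => WithLp.toLp 2 (f ω *ᵥ (g ω).ofLp) := by
  refine measurable_vec_iff.2 fun i => ?_
  simp only [Matrix.mulVec, dotProduct]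
  exact Finset.measurable_fun_sum _ fun j _ =>
    (measurable_mat_iff.1 hf i j).mul (measurable_vec_iff.1 hg j)

/-- A matrix as a vector of its entries; this preserves the Frobenius norm. -/
noncomputable def flatten (A : Mat d) : EuclideanSpace ℝ (Fin d × Fin d) :=
  WithLp.toLp 2 fun q => A q.1 q.2

theorem norm_flatten (A : Mat d) : ‖flatten A‖ = ‖A‖ := by
  refine (pow_left_inj₀ (norm_nonneg _) (norm_nonneg _) two_ne_zero).1 ?_
  rw [frobenius_norm_sq, EuclideanSpace.norm_sq_eq, Fintype.sum_prod_type]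
  simp [flatten]

theorem flatten_add (A B : Mat d) : flatten (A + B) = flatten A + flatten B := rfl

theorem measurable_mat_norm {f : α → Mat d} (hf : Measurable f) :
    Measurable fun ω => ‖f ω‖ := by
  simp only [← norm_flatten]
  refine measurable_norm.comp ((WithLp.measurable_toLp 2 _).comp
    (measurable_pi_iff.2 fun q => ?_))
  exact measurable_mat_iff.1 hf q.1 q.2

theorem measurable_mat_add {f g : α → Mat d} (hf : Measurable f) (hg : Measurable g) :
    Measurable fun ω => f ω + g ω :=
  measurable_mat_iff.2 fun i j => (measurable_mat_iff.1 hf i j).add (measurable_mat_iff.1 hg i j)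

theorem measurable_mat_sub {f g : α → Mat d} (hf : Measurable f) (hg : Measurable g) :
    Measurable fun ω => f ω - g ω :=
  measurable_mat_iff.2 fun i j => (measurable_mat_iff.1 hf i j).sub (measurable_mat_iff.1 hg i j)

theorem measurable_outer {f : α → Vec d} (hf : Measurable f) :
    Measurable fun ω => outer (f ω) :=
  measurable_mat_iff.2 fun i j => (measurable_vec_iff.1 hf i).mul (measurable_vec_iff.1 hf j)

end MatrixMeasurability

theorem abs_outer_apply_le {d : ℕ} {x : Vec d} (hx : ‖x‖ ≤ 1) (i j : Fin d) :
    |outer x i j| ≤ 1 := by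
  have h : ∀ k, |x k| ≤ 1 := fun k => (PiLp.norm_apply_le x k).trans hx
  rw [outer, Matrix.vecMulVec_apply, abs_mul]
  exact mul_le_one₀ (h i) (abs_nonneg _) (h j)

/-! ### One step of the interaction -/

/-- The mean of the outer product of the action `a D` when the pair (decision set, noise) has
law `ν`. -/
noncomputable def meanOuter {d : ℕ} (ν : Measure (DecisionSet d × ℝ)) (a : DecisionSet d → Vec d) :
    Mat d :=
  Matrix.of fun i j => ∫ y, outer (a y.1) i j ∂ν

theorem integrable_outer {d : ℕ} {ν : Measure (DecisionSet d × ℝ)} [IsProbabilityMeasure ν]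
    {a : DecisionSet d → Vec d} (ha : Measurable a) (hb : ∀ᵐ y ∂ν, ‖a y.1‖ ≤ 1) (i j : Fin d) :
    Integrable (fun y => outer (a y.1) i j) ν := by
  refine Integrable.of_bound (C := 1) ?_ ?_
  · exact (measurable_mat_iff.1 (measurable_outer (ha.comp measurable_fst)) i
      j).aestronglyMeasurable
  · filter_upwards [hb] with y hy
    exact abs_outer_apply_le hy i j

theorem meanOuter_posSemidef {d : ℕ} {ν : Measure (DecisionSet d × ℝ)} [IsProbabilityMeasure ν]
    {a : DecisionSet d → Vec d} (ha : Measurable a) (hb : ∀ᵐ y ∂ν, ‖a y.1‖ ≤ 1) :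
    (meanOuter ν a).PosSemidef := by
  refine Matrix.PosSemidef.of_dotProduct_mulVec_nonneg ?_ fun u => ?_
  · ext i j
    simp [meanOuter, outer, Matrix.vecMulVec_apply, mul_comm]
  -- The form of the mean is the mean of a square.
  · have h : star u ⬝ᵥ (meanOuter ν a *ᵥ u) = ∫ y, ((a y.1).ofLp ⬝ᵥ u) ^ 2 ∂ν := by
      have hsq : ∀ y : DecisionSet d × ℝ, ((a y.1).ofLp ⬝ᵥ u) ^ 2
          = ∑ i, ∑ j, u i * (outer (a y.1) i j * u j) := fun y => by
        rw [← form_vecMulVec_self, ← outer]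
        simp only [dotProduct, Matrix.mulVec, Finset.mul_sum]
      simp only [hsq, star_trivial]
      simp only [dotProduct, Matrix.mulVec, meanOuter, Matrix.of_apply, Finset.mul_sum]
      rw [integral_finsetSum _ fun i _ => integrable_finsetSum _ fun j _ =>
        ((integrable_outer ha hb i j).mul_const _).const_mul _]
      refine Finset.sum_congr rfl fun i _ => ?_
      rw [integral_finsetSum _ fun j _ => ((integrable_outer ha hb i j).mul_const _).const_mul _]
      refine Finset.sum_congr rfl fun j _ => ?_
      rw [← integral_mul_const, ← integral_const_mul]
    rw [h]
    exact integral_nonneg fun y => sq_nonneg _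

section Step

variable {Ω Ω' : Type*} {mΩ : MeasurableSpace Ω} {mΩ' : MeasurableSpace Ω'} {d : ℕ}
  {μ : Measure Ω} [IsProbabilityMeasure μ] {p : Ω → Ω'} {ξ : Ω → DecisionSet d × ℝ}
  {κ : Kernel Ω' (DecisionSet d × ℝ)} [IsMarkovKernel κ] {a : Ω' → DecisionSet d → Vec d}

/-- The bound is known only for decision sets that actually occur; here it passes to almost every
set drawn from the conditional law. -/
theorem ae_ae_norm_action_le (hp : Measurable p) (hξ : Measurable ξ)
    (h : μ.map (fun ω => (p ω, ξ ω)) = (μ.map p) ⊗ₘ κ)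
    (ha : Measurable fun z : Ω' × DecisionSet d => a z.1 z.2)
    (hb : ∀ ω, ‖a (p ω) (ξ ω).1‖ ≤ 1) :
    ∀ᵐ ω ∂μ, ∀ᵐ y ∂(κ (p ω)), ‖a (p ω) y.1‖ ≤ 1 := by
  refine ae_ae_of_map_eq hp hξ h (P := fun z => ‖a z.1 z.2.1‖ ≤ 1) ?_
    (Filter.Eventually.of_forall hb)
  have : Measurable fun z : Ω' × DecisionSet d × ℝ => a z.1 z.2.1 :=
    ha.comp (measurable_fst.prodMk (measurable_fst.comp measurable_snd))
  exact measurableSet_le this.norm measurable_const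

theorem measurable_meanOuter (ha : Measurable fun z : Ω' × DecisionSet d => a z.1 z.2) :
    Measurable fun ω' => meanOuter (κ ω') (a ω') := by
  refine measurable_mat_iff.2 fun i j => ?_
  have h1 : Measurable fun z : Ω' × DecisionSet d × ℝ => a z.1 z.2.1 :=
    ha.comp (measurable_fst.prodMk (measurable_fst.comp measurable_snd))
  have h2 := (measurable_mat_iff.1 (measurable_outer h1) i j).stronglyMeasurable
  exact (h2.integral_kernel_prod_right' (κ := κ)).measurable

theorem condExp_outer_ae_eq (hp : Measurable p) (hξ : Measurable ξ)
    (h : μ.map (fun ω => (p ω, ξ ω)) = (μ.map p) ⊗ₘ κ)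
    (ha : Measurable fun z : Ω' × DecisionSet d => a z.1 z.2)
    (hb : ∀ ω, ‖a (p ω) (ξ ω).1‖ ≤ 1) (i j : Fin d) :
    μ[fun ω => outer (a (p ω) (ξ ω).1) i j | mΩ'.comap p]
      =ᵐ[μ] fun ω => meanOuter (κ (p ω)) (a (p ω)) i j := by
  have h1 : Measurable fun z : Ω' × DecisionSet d × ℝ => a z.1 z.2.1 :=
    ha.comp (measurable_fst.prodMk (measurable_fst.comp measurable_snd))
  have h2 := measurable_mat_iff.1 (measurable_outer h1) i j
  refine condExp_comap_ae_eq_integral_kernel hp hξ h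
    (g := fun z : Ω' × DecisionSet d × ℝ => outer (a z.1 z.2.1) i j) h2 ?_
  exact Integrable.of_bound (C := 1) (h2.comp (hp.prodMk hξ)).aestronglyMeasurable
    (Filter.Eventually.of_forall fun ω => abs_outer_apply_le (hb ω) i j)

/-- Freeze the history and integrate over the fresh pair: `S (p ω)` is then a fixed vector and the
increment is centred. -/
theorem lintegral_cosh_gram_step_le (hp : Measurable p) (hξ : Measurable ξ)
    (h : μ.map (fun ω => (p ω, ξ ω)) = (μ.map p) ⊗ₘ κ)
    (ha : Measurable fun z : Ω' × DecisionSet d => a z.1 z.2)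
    (hb : ∀ ω, ‖a (p ω) (ξ ω).1‖ ≤ 1) {σ : ℝ} (hσ : 0 ≤ σ)
    (hvar : ∀ᵐ ω ∂μ, ‖outer (a (p ω) (ξ ω).1) - meanOuter (κ (p ω)) (a (p ω))‖ ≤ σ)
    {S : Ω' → Mat d} (hS : Measurable S) {l : ℝ} (hl : 0 ≤ l) :
    ∫⁻ ω, ENNReal.ofReal (Real.cosh (l *
        ‖S (p ω) + (outer (a (p ω) (ξ ω).1) - meanOuter (κ (p ω)) (a (p ω)))‖)) ∂μ
      ≤ ENNReal.ofReal (Real.exp (l ^ 2 * σ ^ 2 / 2)) *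
        ∫⁻ ω, ENNReal.ofReal (Real.cosh (l * ‖S (p ω)‖)) ∂μ := by
  have h1 : Measurable fun z : Ω' × DecisionSet d × ℝ => a z.1 z.2.1 :=
    ha.comp (measurable_fst.prodMk (measurable_fst.comp measurable_snd))
  have hX : Measurable fun z : Ω' × DecisionSet d × ℝ =>
      outer (a z.1 z.2.1) - meanOuter (κ z.1) (a z.1) :=
    measurable_mat_sub (measurable_outer h1) ((measurable_meanOuter ha).comp measurable_fst)
  have hg : Measurable fun u : ℝ => ENNReal.ofReal (Real.cosh (l * u)) := by fun_prop
  have hf : Measurable fun z : Ω' × DecisionSet d × ℝ => ENNReal.ofReal (Real.cosh (l *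
      ‖S z.1 + (outer (a z.1 z.2.1) - meanOuter (κ z.1) (a z.1))‖)) :=
    hg.comp (measurable_mat_norm (measurable_mat_add (hS.comp measurable_fst) hX))
  have hSp : Measurable fun ω => ENNReal.ofReal (Real.cosh (l * ‖S (p ω)‖)) :=
    hg.comp (measurable_mat_norm (hS.comp hp))
  rw [lintegral_comp_eq_of_map_eq hp hξ h hf, ← lintegral_const_mul _ hSp]
  have hvar' := ae_ae_of_map_eq hp hξ h
    (P := fun z => ‖outer (a z.1 z.2.1) - meanOuter (κ z.1) (a z.1)‖ ≤ σ)
    (measurableSet_le (measurable_mat_norm hX) measurable_const) hvar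
  refine lintegral_mono_ae ?_
  filter_upwards [hvar', ae_ae_norm_action_le hp hξ h ha hb] with ω hω hbω
  have hao : Measurable (a (p ω)) := ha.comp (measurable_const.prodMk measurable_id)
  have hint : ∀ i j, Integrable (fun y : DecisionSet d × ℝ =>
      outer (a (p ω) y.1) i j - meanOuter (κ (p ω)) (a (p ω)) i j) (κ (p ω)) := fun i j =>
    (integrable_outer hao hbω i j).sub (integrable_const _)
  -- `flatten` supplies the inner product behind the Frobenius norm; centring can then be checked
  -- entry by entry.
  have hinner : ∀ y : DecisionSet d × ℝ, inner ℝ (flatten (S (p ω)))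
      (flatten (outer (a (p ω) y.1) - meanOuter (κ (p ω)) (a (p ω))))
      = ∑ q : Fin d × Fin d, S (p ω) q.1 q.2 *
        (outer (a (p ω) y.1) q.1 q.2 - meanOuter (κ (p ω)) (a (p ω)) q.1 q.2) := fun y => by
    rw [EuclideanSpace.inner_eq_star_dotProduct]
    simp [flatten, dotProduct, mul_comm]
  have key := lintegral_cosh_norm_add_le_of_bounded (κ (p ω))
    (fun y => flatten (outer (a (p ω) y.1) - meanOuter (κ (p ω)) (a (p ω))))
    (flatten (S (p ω))) hσ ?_ ?_ ?_ l hl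
  · simpa only [← flatten_add, norm_flatten] using key
  · filter_upwards [hω] with y hy
    rwa [norm_flatten]
  · simp only [hinner]
    exact integrable_finsetSum _ fun q _ => (hint q.1 q.2).const_mul _
  · simp only [hinner]
    rw [integral_finsetSum _ fun q _ => (hint q.1 q.2).const_mul _]
    refine Finset.sum_eq_zero fun q _ => ?_
    rw [integral_const_mul, integral_sub (integrable_outer hao hbω _ _) (integrable_const _)]
    simp [meanOuter]

/-- Independence of decision set and noise factors the kernel. For a fixed set the action is a fixed
vector of norm at most one, and the scalar sub-Gaussian step applies to the noise. -/
theorem lintegral_cosh_noise_step_le (hp : Measurable p) (hξ : Measurable ξ)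
    (h : μ.map (fun ω => (p ω, ξ ω)) = (μ.map p) ⊗ₘ κ)
    (ha : Measurable fun z : Ω' × DecisionSet d => a z.1 z.2)
    (hb : ∀ ω, ‖a (p ω) (ξ ω).1‖ ≤ 1) {R : ℝ}
    (hind : ∀ ω', κ ω' = ((κ ω').map Prod.fst).prod ((κ ω').map Prod.snd))
    (hsub : ∀ ω', HasSubgaussianMGF id ⟨R ^ 2, sq_nonneg R⟩ ((κ ω').map Prod.snd))
    {S : Ω' → Vec d} (hS : Measurable S) {l : ℝ} (hl : 0 ≤ l) :
    ∫⁻ ω, ENNReal.ofReal (Real.cosh (l * ‖S (p ω) + (ξ ω).2 • a (p ω) (ξ ω).1‖)) ∂μ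
      ≤ ENNReal.ofReal (Real.exp (l ^ 2 * R ^ 2 / 2)) *
        ∫⁻ ω, ENNReal.ofReal (Real.cosh (l * ‖S (p ω)‖)) ∂μ := by
  have h1 : Measurable fun z : Ω' × DecisionSet d × ℝ => a z.1 z.2.1 :=
    ha.comp (measurable_fst.prodMk (measurable_fst.comp measurable_snd))
  have h2 : Measurable fun z : Ω' × DecisionSet d × ℝ => z.2.2 :=
    measurable_snd.comp measurable_snd
  have hg : Measurable fun u : ℝ => ENNReal.ofReal (Real.cosh (l * u)) := by fun_prop
  have hf : Measurable fun z : Ω' × DecisionSet d × ℝ => ENNReal.ofReal (Real.cosh (l *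
      ‖S z.1 + z.2.2 • a z.1 z.2.1‖)) :=
    hg.comp ((hS.comp measurable_fst).add (h2.smul h1)).norm
  have hSp : Measurable fun ω => ENNReal.ofReal (Real.cosh (l * ‖S (p ω)‖)) :=
    hg.comp (hS.comp hp).norm
  rw [lintegral_comp_eq_of_map_eq hp hξ h hf, ← lintegral_const_mul _ hSp]
  refine lintegral_mono_ae ?_
  filter_upwards [ae_ae_norm_action_le hp hξ h ha hb] with ω hbω
  have hao : Measurable (a (p ω)) := ha.comp (measurable_const.prodMk measurable_id)
  have hp1 : IsProbabilityMeasure ((κ (p ω)).map Prod.fst) :=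
    Measure.isProbabilityMeasure_map measurable_fst.aemeasurable
  have hp2 : IsProbabilityMeasure ((κ (p ω)).map Prod.snd) :=
    Measure.isProbabilityMeasure_map measurable_snd.aemeasurable
  have hb1 : ∀ᵐ D ∂((κ (p ω)).map Prod.fst), ‖a (p ω) D‖ ≤ 1 :=
    (ae_map_iff measurable_fst.aemeasurable
      (measurableSet_le hao.norm measurable_const)).2 hbω
  have hf2 : Measurable fun y : DecisionSet d × ℝ => ENNReal.ofReal (Real.cosh (l *
      ‖S (p ω) + y.2 • a (p ω) y.1‖)) := 
    hg.comp (measurable_const.add (measurable_snd.smul (hao.comp measurable_fst))).norm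
  have hle : ∀ᵐ D ∂((κ (p ω)).map Prod.fst),
      ∫⁻ η, ENNReal.ofReal (Real.cosh (l * ‖S (p ω) + η • a (p ω) D‖)) ∂((κ (p ω)).map Prod.snd)
        ≤ ENNReal.ofReal (Real.exp (l ^ 2 * R ^ 2 / 2)) *
          ENNReal.ofReal (Real.cosh (l * ‖S (p ω)‖)) := by
    filter_upwards [hb1] with D hD
    exact lintegral_cosh_norm_add_smul_le_of_subgaussian _ (hsub (p ω)) _ _ hD l hl
  have hlp := lintegral_prod (μ := (κ (p ω)).map Prod.fst) (ν := (κ (p ω)).map Prod.snd) _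
    hf2.aemeasurable
  rw [← hind (p ω)] at hlp
  refine hlp.trans_le ((lintegral_mono_ae hle).trans ?_)
  rw [lintegral_const, measure_univ, mul_one]

end Step

/-! ### Probability of the concentration event -/

section Probability

variable {Ω : Type*} {d N : ℕ} [mΩ : MeasurableSpace Ω] {μ : Measure Ω} {ℱ : Filtration ℕ mΩ}
  {T L : ℕ} {R σ : ℝ} {e : Env Ω d N} {r : Run Ω d N} {lam : ℕ → ℝ}
  {pick : ℕ → Vec d → Mat d → DecisionSet d → Vec d}

/-- The law of (decision set, noise) at step `t` as a kernel on the history. -/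
noncomputable def lawKernel (he : e.Valid μ ℱ T R) {t : ℕ} (ht : t < T) :
    @Kernel Ω (DecisionSet d × ℝ) (ℱ t) _ :=
  @Kernel.mk Ω (DecisionSet d × ℝ) (ℱ t) _ (e.law t) (he.measurable_law t ht)

instance isMarkovKernel_lawKernel (he : e.Valid μ ℱ T R) {t : ℕ} (ht : t < T) :
    @IsMarkovKernel Ω (DecisionSet d × ℝ) (ℱ t) _ (lawKernel he ht) :=
  @IsMarkovKernel.mk Ω (DecisionSet d × ℝ) (ℱ t) _ (lawKernel he ht) (he.prob_law t ht)

theorem Env.Valid.measurable_pair (he : e.Valid μ ℱ T R) {t : ℕ} (ht : t < T) {i : Fin N}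
    (hi : i ∈ e.reliable t) : Measurable[mΩ] fun ω => (e.D t i ω, e.η t i ω) :=
  ((he.measurable_D t ht i hi).mono (ℱ.le _) le_rfl).prodMk
    ((he.measurable_η t ht i hi).mono (ℱ.le _) le_rfl)

theorem Env.Valid.map_pair_eq [IsProbabilityMeasure μ] (he : e.Valid μ ℱ T R) {t : ℕ} (ht : t < T)
    {i : Fin N} (hi : i ∈ e.reliable t) :
    @Measure.map Ω (Ω × DecisionSet d × ℝ) mΩ (@Prod.instMeasurableSpace _ _ (ℱ t) _)
      (fun ω => (id ω, (e.D t i ω, e.η t i ω))) μ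
      = (@Measure.map Ω Ω mΩ (ℱ t) id μ) ⊗ₘ (lawKernel he ht) := by
  refine map_prodMk_eq_compProd (mΩ' := ℱ t) (measurable_id'' (ℱ.le t)) (he.measurable_pair ht hi)
    fun A hA B hB => ?_
  -- Taking the whole space for every other agent extracts the conditional law of agent `i`.
  have h := he.condIID t ht A hA (fun j => if j = i then B else Set.univ) (fun j => by
    split_ifs
    · exact hB
    · exact MeasurableSet.univ)
  have hset : (⋂ j ∈ e.reliable t, {ω | (e.D t j ω, e.η t j ω) ∈
      (fun j => if j = i then B else Set.univ) j})
      = (fun ω => (e.D t i ω, e.η t i ω)) ⁻¹' B := by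
    ext ω
    simp only [Set.mem_iInter]
    constructor
    · intro hω
      have := hω i hi
      simpa using this
    · intro hω j hj
      by_cases hji : j = i
      · subst hji
        simpa using hω
      · simp [hji]
  have hprod : ∀ ω, ∏ j ∈ e.reliable t, e.law t ω ((fun j => if j = i then B else Set.univ) j)
      = e.law t ω B := by
    intro ω
    have := he.prob_law t ht ω
    rw [Finset.prod_eq_single_of_mem i hi]
    · simp
    · intro j _ hji
      simp [hji]
  rw [hset] at h
  simp only [hprod] at h
  exact h

/-- The action that an uncorrupted agent chooses at step `t` from a decision set. -/
noncomputable def policy (r : Run Ω d N) (lam : ℕ → ℝ)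
    (pick : ℕ → Vec d → Mat d → DecisionSet d → Vec d) (L t : ℕ) (ω : Ω) (D : DecisionSet d) :
    Vec d :=
  pick t (r.θ lam (t / L) ω) (r.Λ lam (t / L) ω) D

/-- The conditional mean of the outer product of an action at step `t`. -/
noncomputable def condMeanOuter (e : Env Ω d N) (r : Run Ω d N) (lam : ℕ → ℝ)
    (pick : ℕ → Vec d → Mat d → DecisionSet d → Vec d) (L t : ℕ) (ω : Ω) : Mat d :=
  meanOuter (e.law t ω) (policy r lam pick L t ω)

/-- The broadcast estimate dates from `t / L * L ≤ t`, hence belongs to the history; at step `t`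
only the new pair is random. -/
theorem Run.IsExecution.measurable_policy (hr : r.IsExecution e ℱ T L lam pick) {β : ℕ → ℝ}
    (hp : IsArgmaxRule β pick) {t : ℕ} (ht : t < T) :
    Measurable[@Prod.instMeasurableSpace _ _ (ℱ t) _] fun z : Ω × DecisionSet d =>
      policy r lam pick L t z.1 z.2 := by
  have hk : t / L * L ≤ t := Nat.div_mul_le_self t L
  have hG : Measurable[ℱ t] (r.G (t / L)) :=
    (hr.measurable_G _ (hk.trans_lt ht)).mono (ℱ.mono hk) le_rfl
  have hb : Measurable[ℱ t] (r.b (t / L)) :=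
    (hr.measurable_b _ (hk.trans_lt ht)).mono (ℱ.mono hk) le_rfl
  have hΛ : Measurable[ℱ t] (r.Λ lam (t / L)) :=
    measurable_mat_add (mα := ℱ t) hG measurable_const
  have hθ : Measurable[ℱ t] (r.θ lam (t / L)) :=
    measurable_mulVec (mα := ℱ t) (measurable_mat_inv (mα := ℱ t) hΛ) hb
  have hfst : @Measurable _ _ (@Prod.instMeasurableSpace _ _ (ℱ t) _) (ℱ t)
    (Prod.fst : Ω × DecisionSet d → Ω) := @measurable_fst _ _ (ℱ t) _
  have hsnd : @Measurable _ _ (@Prod.instMeasurableSpace _ _ (ℱ t) _) _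
    (Prod.snd : Ω × DecisionSet d → DecisionSet d) := @measurable_snd _ _ (ℱ t) _
  exact (hp.meas t).comp ((hθ.comp hfst).prodMk ((hΛ.comp hfst).prodMk hsnd))

theorem Run.IsExecution.norm_policy_le (hr : r.IsExecution e ℱ T L lam pick)
    (he : e.Valid μ ℱ T R) {β : ℕ → ℝ} (hp : IsArgmaxRule β pick) {t : ℕ} (ht : t < T)
    {i : Fin N} (hi : i ∈ e.reliable t) (ω : Ω) :
    ‖policy r lam pick L t ω (e.D t i ω)‖ ≤ 1 :=
  (congrArg norm (hr.action t ht i hi ω)).symm.trans_le (hr.norm_x_le_one he hp ht hi ω)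

theorem Run.IsExecution.measurable_x (hr : r.IsExecution e ℱ T L lam pick)
    (he : e.Valid μ ℱ T R) {β : ℕ → ℝ} (hp : IsArgmaxRule β pick) {t : ℕ} (ht : t < T)
    {i : Fin N} (hi : i ∈ e.reliable t) : Measurable[ℱ (t + 1)] (r.x t i) := by
  have h1 : r.x t i = (fun z : Ω × DecisionSet d => policy r lam pick L t z.1 z.2) ∘
      fun ω => (id ω, e.D t i ω) := funext fun ω => hr.action t ht i hi ω
  rw [h1]
  refine (hr.measurable_policy hp ht).comp ?_
  exact (measurable_id'' (ℱ.mono (Nat.le_succ t))).prodMk (he.measurable_D t ht i hi)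

theorem Run.IsExecution.measurable_condMeanOuter (hr : r.IsExecution e ℱ T L lam pick)
    (he : e.Valid μ ℱ T R) {β : ℕ → ℝ} (hp : IsArgmaxRule β pick) {t : ℕ} (ht : t < T) :
    Measurable[ℱ t] (condMeanOuter e r lam pick L t) :=
  measurable_meanOuter (mΩ' := ℱ t) (κ := lawKernel he ht) (hr.measurable_policy hp ht)

theorem Run.IsExecution.measurable_gramDev (hr : r.IsExecution e ℱ T L lam pick)
    (he : e.Valid μ ℱ T R) {β : ℕ → ℝ} (hp : IsArgmaxRule β pick) (i : Fin N) {n : ℕ}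
    (hn : n ≤ T) : Measurable[ℱ n] (gramDev r e (condMeanOuter e r lam pick L) i n) := by
  refine (measurable_mat_iff (mα := ℱ n)).2 fun a c => ?_
  simp only [gramDev, Matrix.sum_apply]
  refine Finset.measurable_fun_sum (m := ℱ n) _ fun s hs => ?_
  have hsn : s + 1 ≤ n := Finset.mem_range.1 hs
  by_cases hi : i ∈ e.reliable s
  · simp only [if_pos hi]
    have hsT : s < T := hsn.trans hn
    exact (measurable_mat_iff (mα := ℱ n)).1 (measurable_mat_sub (mα := ℱ n)
      (measurable_outer (mα := ℱ n) ((hr.measurable_x he hp hsT hi).mono (ℱ.mono hsn) le_rfl))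
      ((hr.measurable_condMeanOuter he hp hsT).mono (ℱ.mono ((Nat.le_succ s).trans hsn))
        le_rfl)) a c
  · simp only [if_neg hi]
    exact measurable_const

theorem Run.IsExecution.measurable_noiseSum (hr : r.IsExecution e ℱ T L lam pick)
    (he : e.Valid μ ℱ T R) {β : ℕ → ℝ} (hp : IsArgmaxRule β pick) (i : Fin N) {n : ℕ}
    (hn : n ≤ T) : Measurable[ℱ n] (noiseSum r e i n) := by
  refine Finset.measurable_fun_sum (m := ℱ n) _ fun s hs => ?_
  have hsn : s + 1 ≤ n := Finset.mem_range.1 hs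
  by_cases hi : i ∈ e.reliable s
  · simp only [if_pos hi]
    have hsT : s < T := hsn.trans hn
    exact ((he.measurable_η s hsT i hi).mono (ℱ.mono hsn) le_rfl).smul
      ((hr.measurable_x he hp hsT hi).mono (ℱ.mono hsn) le_rfl)
  · simp only [if_neg hi]
    exact measurable_const

variable [IsProbabilityMeasure μ]

theorem Run.IsExecution.condMeanOuter_posSemidef (hr : r.IsExecution e ℱ T L lam pick)
    (he : e.Valid μ ℱ T R) {β : ℕ → ℝ} (hp : IsArgmaxRule β pick) {t : ℕ} (ht : t < T)
    {i : Fin N} (hi : i ∈ e.reliable t) :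
    ∀ᵐ ω ∂μ, (condMeanOuter e r lam pick L t ω).PosSemidef := by
  have hb : ∀ ω, ‖policy r lam pick L t (id ω) (e.D t i ω, e.η t i ω).1‖ ≤ 1 := fun ω =>
    hr.norm_policy_le he hp ht hi ω
  have h := ae_ae_norm_action_le (mΩ' := ℱ t) (measurable_id'' (ℱ.le t))
    (he.measurable_pair ht hi) (he.map_pair_eq ht hi) (hr.measurable_policy hp ht) hb
  filter_upwards [h] with ω hω
  have := he.prob_law t ht ω
  refine meanOuter_posSemidef ?_ hω
  exact (hp.meas t).comp (measurable_const.prodMk (measurable_const.prodMk measurable_id))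

theorem Run.IsExecution.variance_le (hr : r.IsExecution e ℱ T L lam pick)
    (he : e.Valid μ ℱ T R) {β : ℕ → ℝ} (hp : IsArgmaxRule β pick)
    (hv : r.VarianceBound e μ ℱ T σ) (hσ : 0 ≤ σ) {t : ℕ} (ht : t < T)
    {i : Fin N} (hi : i ∈ e.reliable t) :
    ∀ᵐ ω ∂μ, ‖outer (r.x t i ω) - condMeanOuter e r lam pick L t ω‖ ≤ σ := by
  have hb : ∀ ω, ‖policy r lam pick L t (id ω) (e.D t i ω, e.η t i ω).1‖ ≤ 1 := fun ω =>
    hr.norm_policy_le he hp ht hi ω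
  have hx : ∀ ω, policy r lam pick L t (id ω) (e.D t i ω, e.η t i ω).1 = r.x t i ω := fun ω =>
    (hr.action t ht i hi ω).symm
  have h : ∀ a c, μ[fun ω' => outer (r.x t i ω') a c | ℱ t]
      =ᵐ[μ] fun ω => condMeanOuter e r lam pick L t ω a c := fun a c => by
    have := condExp_outer_ae_eq (mΩ' := ℱ t) (measurable_id'' (ℱ.le t))
      (he.measurable_pair ht hi) (he.map_pair_eq ht hi) (hr.measurable_policy hp ht) hb a c
    simp only [hx, MeasurableSpace.comap_id] at this
    exact this
  -- There are finitely many entries, so one null set serves the whole matrix.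
  have h' : ∀ᵐ ω ∂μ, ∀ a c, (μ[fun ω' => outer (r.x t i ω') a c | ℱ t]) ω
      = condMeanOuter e r lam pick L t ω a c :=
    ae_all_iff.2 fun a => ae_all_iff.2 fun c => h a c
  filter_upwards [hv t ht i hi, h'] with ω hω hω'
  simp only [hω'] at hω
  exact (pow_le_pow_iff_left₀ (norm_nonneg _) hσ two_ne_zero).1 hω

theorem Run.IsExecution.gramDev_tail (hr : r.IsExecution e ℱ T L lam pick)
    (he : e.Valid μ ℱ T R) {β : ℕ → ℝ} (hp : IsArgmaxRule β pick)
    (hv : r.VarianceBound e μ ℱ T σ) (hσ : 0 ≤ σ) {ι : ℝ} (hι : 0 < ι) (i : Fin N) {n : ℕ}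
    (hn : n ≤ T) :
    μ {ω | √(2 * (n * σ ^ 2) * ι) < ‖gramDev r e (condMeanOuter e r lam pick L) i n ω‖}
      ≤ ENNReal.ofReal (2 * Real.exp (-ι)) := by
  refine measure_norm_gt_le_of_lintegral_cosh_le μ _ (measurable_mat_norm
    ((hr.measurable_gramDev he hp i hn).mono (ℱ.le n) le_rfl)).aemeasurable (by positivity) hι
    fun l hl => ?_
  refine lintegral_cosh_norm_le_of_step μ
    (gramDev r e (condMeanOuter e r lam pick L) i) (fun ω => by simp [gramDev]) σ l n
    fun t ht => ?_
  have htT : t < T := ht.trans_le hn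
  by_cases hi : i ∈ e.reliable t
  · have hb : ∀ ω, ‖policy r lam pick L t (id ω) (e.D t i ω, e.η t i ω).1‖ ≤ 1 := fun ω =>
      hr.norm_policy_le he hp htT hi ω
    have hx : ∀ ω, policy r lam pick L t (id ω) (e.D t i ω, e.η t i ω).1 = r.x t i ω := fun ω =>
      (hr.action t htT i hi ω).symm
    have hvar : ∀ᵐ ω ∂μ, ‖outer (policy r lam pick L t (id ω) (e.D t i ω, e.η t i ω).1)
        - condMeanOuter e r lam pick L t ω‖ ≤ σ := by
      simp only [hx]
      exact hr.variance_le he hp hv hσ htT hi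
    have h := lintegral_cosh_gram_step_le (mΩ' := ℱ t) (measurable_id'' (ℱ.le t))
      (he.measurable_pair htT hi) (he.map_pair_eq htT hi) (hr.measurable_policy hp htT) hb hσ hvar
      (hr.measurable_gramDev he hp i htT.le) hl
    simp only [hx] at h
    simp only [gramDev, Finset.sum_range_succ, if_pos hi]
    exact h
  -- At a corrupted step the sum does not move, and the growth factor is at least one.
  · simp only [gramDev, Finset.sum_range_succ, if_neg hi, add_zero]
    refine le_mul_of_one_le_left' ?_
    rw [ENNReal.one_le_ofReal]
    exact Real.one_le_exp (by positivity)

theorem Run.IsExecution.noiseSum_tail (hr : r.IsExecution e ℱ T L lam pick)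
    (he : e.Valid μ ℱ T R) {β : ℕ → ℝ} (hp : IsArgmaxRule β pick) {ι : ℝ} (hι : 0 < ι)
    (i : Fin N) {n : ℕ} (hn : n ≤ T) :
    μ {ω | √(2 * (n * R ^ 2) * ι) < ‖noiseSum r e i n ω‖}
      ≤ ENNReal.ofReal (2 * Real.exp (-ι)) := by
  refine measure_norm_gt_le_of_lintegral_cosh_le μ _
    ((hr.measurable_noiseSum he hp i hn).mono (ℱ.le n) le_rfl).norm.aemeasurable
    (by positivity) hι fun l hl => ?_
  refine lintegral_cosh_norm_le_of_step μ (noiseSum r e i) (fun ω => by simp [noiseSum]) R l n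
    fun t ht => ?_
  have htT : t < T := ht.trans_le hn
  by_cases hi : i ∈ e.reliable t
  · have hb : ∀ ω, ‖policy r lam pick L t (id ω) (e.D t i ω, e.η t i ω).1‖ ≤ 1 := fun ω =>
      hr.norm_policy_le he hp htT hi ω
    have hx : ∀ ω, policy r lam pick L t (id ω) (e.D t i ω, e.η t i ω).1 = r.x t i ω := fun ω =>
      (hr.action t htT i hi ω).symm
    have h := lintegral_cosh_noise_step_le (mΩ' := ℱ t) (measurable_id'' (ℱ.le t))
      (he.measurable_pair htT hi) (he.map_pair_eq htT hi) (hr.measurable_policy hp htT) hb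
      (he.indep t htT) (he.subGaussian t htT) (hr.measurable_noiseSum he hp i htT.le) hl
    simp only [hx] at h
    simp only [noiseSum, Finset.sum_range_succ, if_pos hi]
    exact h
  · simp only [noiseSum, Finset.sum_range_succ, if_neg hi, add_zero]
    refine le_mul_of_one_le_left' ?_
    rw [ENNReal.one_le_ofReal]
    exact Real.one_le_exp (by positivity)

theorem Run.IsExecution.measure_not_concentrated_le (hr : r.IsExecution e ℱ T L lam pick)
    (he : e.Valid μ ℱ T R) {β : ℕ → ℝ} (hp : IsArgmaxRule β pick)
    (hv : r.VarianceBound e μ ℱ T σ) (hσ : 0 ≤ σ) {ι : ℝ} (hι : 0 < ι) (hL : 0 < L)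
    (hne : ∀ t < T, (e.reliable t).Nonempty) :
    μ {ω | ¬ Concentrated r e (condMeanOuter e r lam pick L) T L ι σ R ω}
      ≤ ENNReal.ofReal (4 * (N * T) * Real.exp (-ι)) := by
  set A : ℕ → Fin N → Set Ω := fun n i =>
    {ω | √(2 * (n * σ ^ 2) * ι) < ‖gramDev r e (condMeanOuter e r lam pick L) i n ω‖} with hA
  set B : ℕ → Fin N → Set Ω := fun n i =>
    {ω | √(2 * (n * R ^ 2) * ι) < ‖noiseSum r e i n ω‖} with hB
  set K : Finset ℕ := (Finset.range T).filter fun k => k * L < T with hK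
  have hpsd : ∀ᵐ ω ∂μ, ∀ s, s < T → (condMeanOuter e r lam pick L s ω).PosSemidef :=
    ae_all_iff.2 fun s => by
      by_cases hs : s < T
      -- The mean belongs to the common policy, but integrability of its outer product is deduced
      -- from the norm bound of some uncorrupted agent.
      · obtain ⟨i, hi⟩ := hne s hs
        filter_upwards [hr.condMeanOuter_posSemidef he hp hs hi] with ω hω _ using hω
      · exact Filter.Eventually.of_forall fun ω h => absurd h hs
  have hsub : {ω | ¬ Concentrated r e (condMeanOuter e r lam pick L) T L ι σ R ω}
      ⊆ {ω | ¬ ∀ s, s < T → (condMeanOuter e r lam pick L s ω).PosSemidef}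
        ∪ ⋃ k ∈ K, ⋃ i ∈ (Finset.univ : Finset (Fin N)), (A (k * L) i ∪ B (k * L) i) := by
    intro ω hω
    by_contra hcon
    rw [Set.mem_union, not_or] at hcon
    obtain ⟨h1, h2⟩ := hcon
    -- As `L ≥ 1`, there are at most `T` episode starts; each agent contributes two events of
    -- probability at most `2 exp(-ι)` at each of them.
    have hmem : ∀ k, k * L < T → k ∈ K := fun k hk => Finset.mem_filter.2
      ⟨Finset.mem_range.2 ((Nat.le_mul_of_pos_right k hL).trans_lt hk), hk⟩
    have h3 : ∀ k, k * L < T → ∀ i, ω ∉ A (k * L) i ∧ ω ∉ B (k * L) i := fun k hk i => by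
      rw [← not_or, ← Set.mem_union]
      intro hmem'
      exact h2 (Set.mem_biUnion (hmem k hk) (Set.mem_biUnion (Finset.mem_univ i) hmem'))
    exact hω ⟨not_not.1 h1, fun k hk i => not_lt.1 (h3 k hk i).1,
      fun k hk i => not_lt.1 (h3 k hk i).2⟩
  have hAB : ∀ k ∈ K, ∀ i, μ (A (k * L) i ∪ B (k * L) i)
      ≤ ENNReal.ofReal (4 * Real.exp (-ι)) := fun k hk i => by
    have hkT := (Finset.mem_filter.1 hk).2.le
    refine (measure_union_le _ _).trans ((add_le_add (hr.gramDev_tail he hp hv hσ hι i hkT)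
      (hr.noiseSum_tail he hp hι i hkT)).trans ?_)
    rw [← ENNReal.ofReal_add (by positivity) (by positivity)]
    exact ENNReal.ofReal_le_ofReal (by linarith)
  calc _ ≤ _ := measure_mono hsub
    _ ≤ 0 + ∑ k ∈ K, ∑ _i : Fin N, ENNReal.ofReal (4 * Real.exp (-ι)) := by
        refine (measure_union_le _ _).trans (add_le_add (le_of_eq hpsd) ?_)
        refine (measure_biUnion_finset_le _ _).trans (Finset.sum_le_sum fun k hk => ?_)
        exact (measure_biUnion_finset_le _ _).trans (Finset.sum_le_sum fun i _ => hAB k hk i)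
    _ ≤ 0 + ∑ k ∈ Finset.range T, ∑ _i : Fin N, ENNReal.ofReal (4 * Real.exp (-ι)) := by
        gcongr
        exact Finset.filter_subset _ _
    _ = _ := by
        simp only [Finset.sum_const, Finset.card_range, Finset.card_univ, Fintype.card_fin,
          nsmul_eq_mul, zero_add]
        rw [← ENNReal.ofReal_natCast, ← ENNReal.ofReal_natCast,
          ← ENNReal.ofReal_mul (by positivity), ← ENNReal.ofReal_mul (by positivity)]
        congr 1
        ring

end Probability

/-! ### The regret rate -/

section Rate

theorem one_le_iota {N T : ℕ} {δ : ℝ} (hN : 0 < N) (hT : 0 < T) (hδ : 0 < δ) (hδ1 : δ < 1) :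
    1 ≤ iota N T δ := by
  have hN1 : (1 : ℝ) ≤ N := by exact_mod_cast hN
  have hT1 : (1 : ℝ) ≤ T := by exact_mod_cast hT
  rw [iota, Real.le_log_iff_exp_le (by positivity), le_div_iff₀ hδ]
  have h1 := Real.exp_one_lt_d9
  have h2 : (1 : ℝ) ≤ N * T := one_le_mul_of_one_le_of_one_le hN1 hT1
  nlinarith [Real.exp_pos 1]

theorem log_one_add_div_le_iota {N T L : ℕ} {δ : ℝ} (hN : 0 < N) (hT : 0 < T) (hL : 0 < L)
    (hδ : 0 < δ) (hδ1 : δ < 1) : Real.log (1 + T / L) ≤ iota N T δ := by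
  have hN1 : (1 : ℝ) ≤ N := by exact_mod_cast hN
  have hT1 : (1 : ℝ) ≤ T := by exact_mod_cast hT
  have hL1 : (1 : ℝ) ≤ L := by exact_mod_cast hL
  refine Real.log_le_log (by positivity) ?_
  have h1 : (T : ℝ) / L ≤ T := div_le_self (by positivity) hL1
  have h2 : (T : ℝ) ≤ N * T := le_mul_of_one_le_left (by positivity) hN1
  have h3 : 128 * N * T ≤ 128 * N * T / δ := le_div_self (by positivity) hδ hδ1.le
  linarith

theorem exp_neg_iota {N T : ℕ} {δ : ℝ} (hN : 0 < N) (hT : 0 < T) (hδ : 0 < δ) :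
    4 * (N * T) * Real.exp (-iota N T δ) ≤ δ := by
  have hN1 : (0 : ℝ) < N := by exact_mod_cast hN
  have hT1 : (0 : ℝ) < T := by exact_mod_cast hT
  rw [iota, Real.exp_neg, Real.exp_log (by positivity), inv_div, mul_div_assoc', div_le_iff₀
    (by positivity)]
  have : 0 < N * T * δ := by positivity
  linarith

variable {d N T L k : ℕ} {ι C σ R : ℝ}

/-- Since `(k + 1) L ≤ T + L ≤ 2T`, the second term of `reg` costs `8 · 3/2 = 12`. This is where `L
≤ T` enters. -/
theorem reg_le (hLT : L ≤ T) (hk : k * L < T) (hι : 0 ≤ ι) (hC : 0 ≤ C) (hσ : 0 ≤ σ) :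
    reg L ι C σ k ≤ 12 * (L + C * σ * √(T * ι)) := by
  have h0 : 0 ≤ C * σ * √(T * ι) := by positivity
  refine max_le (by have : (0 : ℝ) ≤ L := Nat.cast_nonneg L
                    linarith) ?_
  have h1 : √(L * ι) * √((k : ℝ) + 1) ≤ 3 / 2 * √(T * ι) := by
    rw [← Real.sqrt_mul (by positivity)]
    refine le_trans (Real.sqrt_le_sqrt ?_) sqrt_two_mul_le
    have h2 : (k : ℝ) * L + L ≤ 2 * T := by
      have : k * L + L ≤ 2 * T := by omega
      exact_mod_cast this
    have := mul_le_mul_of_nonneg_right h2 hι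
    linarith
  have h3 := mul_le_mul_of_nonneg_left h1 (mul_nonneg hC hσ)
  have : (0 : ℝ) ≤ L := Nat.cast_nonneg L
  linarith

/-- Makes the second term of `conf` uniform in `k`: with `n = k L`, `λ_k` may be smaller in early
episodes, but it grows at most like `√n` whereas the numerator squared grows like `n`. The
comparison is `n√T ≤ T√n`. -/
theorem sqrt_mul_sqrt_le (hk : k * L < T) (hι : 0 ≤ ι) (hC : 0 ≤ C) (hσ : 0 ≤ σ) :
    √((k * L : ℕ) * ι) * √(L + C * σ * √(T * ι)) ≤ 2 * (√(T * ι) * √(reg L ι C σ k)) := by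
  set n := k * L with hn
  have hLlam : (L : ℝ) ≤ reg L ι C σ k := le_max_left _ _
  have hlam0 : 0 ≤ reg L ι C σ k := (Nat.cast_nonneg L).trans hLlam
  have h1 := mul_sqrt_le_reg L hι hC hσ k
  rw [← hn] at h1
  have hnT : (n : ℝ) ≤ T := by exact_mod_cast hk.le
  have h2 : n * √(T * ι) ≤ T * √(n * ι) := by
    rw [Real.sqrt_mul (Nat.cast_nonneg _), Real.sqrt_mul (Nat.cast_nonneg _)]
    have h3 : √(n : ℝ) ≤ √T := Real.sqrt_le_sqrt hnT
    have h4 : (n : ℝ) = √n * √n := (Real.mul_self_sqrt (Nat.cast_nonneg n)).symm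
    have h5 : (T : ℝ) = √T * √T := (Real.mul_self_sqrt (Nat.cast_nonneg T)).symm
    calc (n : ℝ) * (√T * √ι) = √n * √n * (√T * √ι) := by rw [← h4]
      _ = √n * (√n * √T * √ι) := by ring
      _ ≤ √T * (√n * √T * √ι) := by gcongr
      _ = √T * √T * (√n * √ι) := by ring
      _ = T * (√n * √ι) := by rw [← h5]
  rw [← Real.sqrt_mul (by positivity), ← Real.sqrt_mul (by positivity)]
  have h4 : (2 : ℝ) = √(2 ^ 2) := (Real.sqrt_sq zero_le_two).symm
  rw [h4, ← Real.sqrt_mul (by positivity)]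
  refine Real.sqrt_le_sqrt ?_
  have h5 : (n : ℝ) * L ≤ T * reg L ι C σ k := mul_le_mul hnT hLlam (by positivity) (by positivity)
  have h6 := mul_le_mul_of_nonneg_left h2 (mul_nonneg hC hσ)
  have h7 : (T : ℝ) * (8 * (C * σ * √(n * ι))) ≤ T * reg L ι C σ k := by gcongr
  have h8 : (n : ℝ) * (L + C * σ * √(T * ι)) ≤ 4 * (T * reg L ι C σ k) := by
    have : 0 ≤ (T : ℝ) * reg L ι C σ k := by positivity
    linarith
  have h9 := mul_le_mul_of_nonneg_right h8 hι
  linarith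

theorem conf_le (hL : 0 < L) (hLT : L ≤ T) (hk : k * L < T) (hι : 0 ≤ ι) (hC : 0 ≤ C)
    (hσ : 0 ≤ σ) (hR : 0 ≤ R) :
    conf d N L ι C σ R k ≤ 11 * (√d * (√(L + C * σ * √(T * ι))
      + √(T * ι) * C * (σ + R) / √(L + C * σ * √(T * ι)))) + 2 * R * √(d * ι / N) := by
  have hlam := reg_pos hL ι C σ k
  have hP : 0 < L + C * σ * √(T * ι) := by
    have : (0 : ℝ) < L := by exact_mod_cast hL
    positivity
  have h1 := reg_le hLT hk hι hC hσ
  have h2 := sqrt_mul_sqrt_le hk hι hC hσ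
  rw [conf]
  set lam := reg L ι C σ k
  set P := L + C * σ * √(T * ι)
  have hsl : 0 < √lam := Real.sqrt_pos.2 hlam
  have hsP : 0 < √P := Real.sqrt_pos.2 hP
  -- `(11/3)² ≥ 12`, and the factor `3` in `conf` turns `11/3` into `11`.
  have h3 : √(lam * d) ≤ 11 / 3 * √P * √d := by
    rw [Real.sqrt_mul hlam.le]
    refine mul_le_mul_of_nonneg_right (Real.sqrt_le_iff.2 ⟨by positivity, ?_⟩)
      (Real.sqrt_nonneg _)
    rw [mul_pow, Real.sq_sqrt hP.le]
    linarith
  have h4 : √((k : ℝ) * L * d * ι) = √((k * L : ℕ) * ι) * √d := by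
    rw [← Real.sqrt_mul (by positivity)]; push_cast; congr 1; ring
  have h5 : 4 * √((k : ℝ) * L * d * ι) * C * (σ + R) / √lam
      ≤ 11 * (√d * (√(T * ι) * C * (σ + R) / √P)) := by
    have h6 : √((k * L : ℕ) * ι) / √lam ≤ 2 * √(T * ι) / √P := by
      rw [div_le_div_iff₀ hsl hsP]
      linarith
    have h7 : 0 ≤ √d * C * (σ + R) := by positivity
    have h8 := mul_le_mul_of_nonneg_left h6 h7
    have h9 : 0 ≤ √d * (√(T * ι) * C * (σ + R) / √P) := by positivity
    calc _ = 4 * (√d * C * (σ + R) * (√((k * L : ℕ) * ι) / √lam)) := by rw [h4]; ring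
      _ ≤ 4 * (√d * C * (σ + R) * (2 * √(T * ι) / √P)) := by linarith
      _ = 8 * (√d * (√(T * ι) * C * (σ + R) / √P)) := by ring
      _ ≤ _ := by linarith
  linarith

/-- With `√8 ≤ 3` the main term has constant `2 · 11 · 3 = 66`; the noise term needs only `12`. -/
theorem bound_le_regretRate (hN : 0 < N) (hι : 0 ≤ ι) (hC : 0 ≤ C) (hσ : 0 ≤ σ) (hR : 0 ≤ R) :
    2 * (11 * (√d * (√(L + C * σ * √(T * ι))
      + √(T * ι) * C * (σ + R) / √(L + C * σ * √(T * ι)))) + 2 * R * √(d * ι / N))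
      * (N * √(8 * (T * d * ι))) ≤ 66 * regretRate d N T L ι C σ R := by
  rw [regretRate]
  set Q := √(L + C * σ * √(T * ι)) + √(T * ι) * C * (σ + R) / √(L + C * σ * √(T * ι)) with hQ
  have hQ0 : 0 ≤ Q := by positivity
  have hsN : 0 < √(N : ℝ) := Real.sqrt_pos.2 (by exact_mod_cast hN)
  have h8 : √(8 * (T * d * ι)) ≤ 3 * (√d * √(T * ι)) := by
    rw [← Real.sqrt_mul (Nat.cast_nonneg d), Real.sqrt_le_iff]
    refine ⟨by positivity, ?_⟩
    rw [mul_pow, Real.sq_sqrt (by positivity)]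
    have : 0 ≤ (d : ℝ) * (T * ι) := by positivity
    linarith
  have hdd : √(d : ℝ) * √d = d := Real.mul_self_sqrt (Nat.cast_nonneg d)
  have hid : √(d * ι / N) * (N * (√d * √(T * ι))) = d * ι * √(N * T) := by
    rw [Real.sqrt_div (by positivity), Real.sqrt_mul (Nat.cast_nonneg d),
      Real.sqrt_mul (Nat.cast_nonneg T), Real.sqrt_mul (Nat.cast_nonneg N)]
    have hNN : (N : ℝ) = √N * √N := (Real.mul_self_sqrt (Nat.cast_nonneg N)).symm
    have hii : √ι * √ι = ι := Real.mul_self_sqrt hι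
    calc √(d : ℝ) * √ι / √N * (N * (√d * (√T * √ι)))
        = (√d * √d) * (√ι * √ι) * (N / √N * √T) := by ring
      _ = _ := by rw [hdd, hii, Real.div_sqrt]
  have hrate1 : 0 ≤ R * (d * ι * √(N * T)) := by positivity
  calc _ ≤ 2 * (11 * (√d * Q) + 2 * R * √(d * ι / N)) * (N * (3 * (√d * √(T * ι)))) := by
        gcongr
    _ = 66 * (N * (√d * √d) * √(T * ι) * Q)
        + 12 * (R * (√(d * ι / N) * (N * (√d * √(T * ι))))) := by ring
    _ = 66 * (N * d * √(T * ι) * Q) + 12 * (R * (d * ι * √(N * T))) := by rw [hdd, hid]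
    _ ≤ _ := by linarith

/-- For `L ≥ T` the factor `√T √L` of the rate is already at least `T`. -/
theorem trivial_bound_le_regretRate (hd : 0 < d) (hLT : T ≤ L) (hι : 1 ≤ ι) (hC : 0 ≤ C)
    (hσ : 0 ≤ σ) (hR : 0 ≤ R) : 2 * √d * N * T ≤ 66 * regretRate d N T L ι C σ R := by
  have hd1 : (1 : ℝ) ≤ d := by exact_mod_cast hd
  have hdd : √(d : ℝ) ≤ d := by
    rw [Real.sqrt_le_left (by positivity)]
    nlinarith
  have h0 : 0 ≤ R * d * ι * √(N * T) := by positivity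
  have h1 : √(T : ℝ) ≤ √(T * ι) :=
    Real.sqrt_le_sqrt (le_mul_of_one_le_right (Nat.cast_nonneg T) hι)
  have h2 : √(T : ℝ) ≤ √(L + C * σ * √(T * ι)) := by
    refine Real.sqrt_le_sqrt ?_
    have : (T : ℝ) ≤ L := by exact_mod_cast hLT
    have : 0 ≤ C * σ * √(T * ι) := by positivity
    linarith
  have h3 : 0 ≤ √(T * ι) * C * (σ + R) / √(L + C * σ * √(T * ι)) := by positivity
  have hTT : √(T : ℝ) * √T = T := Real.mul_self_sqrt (Nat.cast_nonneg T)
  have h4 : (√d : ℝ) * N * T ≤ N * d * √(T * ι) *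
      (√(L + C * σ * √(T * ι)) + √(T * ι) * C * (σ + R) / √(L + C * σ * √(T * ι))) := by
    calc (√d : ℝ) * N * T = √d * N * (√T * √T) := by rw [hTT]
      _ = N * √d * √T * √T := by ring
      _ ≤ _ := by
        have := h2.trans (le_add_of_nonneg_right h3)
        gcongr
  rw [regretRate]
  have h5 : 0 ≤ (√d : ℝ) * N * T := by positivity
  linarith

theorem two_mul_length_ge {X : ℝ} (hL : 0 < L) (h : |(L : ℝ) - C * (σ + R) * X| ≤ 1) :
    C * (σ + R) * X ≤ 2 * L := by
  have hL1 : (1 : ℝ) ≤ L := by exact_mod_cast hL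
  have := (abs_le.1 h).1
  linarith

theorem regretRate_le (hN : 0 < N) (hT : 0 < T) (hL : 0 < L) (hι : 1 ≤ ι) (hC : 0 ≤ C)
    (hσ : 0 ≤ σ) (hR : 0 ≤ R) (h : |(L : ℝ) - C * (σ + R) * √(T * ι)| ≤ 1) :
    regretRate d N T L ι C σ R
      ≤ 5 * (1 + R + √(C * (σ + R))) * ι * (d * N * (T : ℝ) ^ (3 / 4 : ℝ)) := by
  have hL1 : (1 : ℝ) ≤ L := by exact_mod_cast hL
  have hN1 : (1 : ℝ) ≤ N := by exact_mod_cast hN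
  have hT1 : (1 : ℝ) ≤ T := by exact_mod_cast hT
  have hBX := two_mul_length_ge hL h
  have hL2 := (abs_le.1 h).2
  -- Fourth roots of `T` and `ι` turn all the powers involved into integer ones.
  set τ := √√(T : ℝ) with hτ
  set j := √√ι with hj
  have hτ1 : 1 ≤ τ := by rw [hτ, Real.one_le_sqrt, Real.one_le_sqrt]; exact hT1
  have hj1 : 1 ≤ j := by rw [hj, Real.one_le_sqrt, Real.one_le_sqrt]; exact hι
  have hτ2 : √(T : ℝ) = τ ^ 2 := (Real.sq_sqrt (Real.sqrt_nonneg _)).symm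
  have hj2 : √ι = j ^ 2 := (Real.sq_sqrt (Real.sqrt_nonneg _)).symm
  have hT4 : (T : ℝ) = τ ^ 4 := by
    rw [show (4 : ℕ) = 2 * 2 from rfl, pow_mul, ← hτ2, Real.sq_sqrt (Nat.cast_nonneg T)]
  have hι4 : ι = j ^ 4 := by
    rw [show (4 : ℕ) = 2 * 2 from rfl, pow_mul, ← hj2, Real.sq_sqrt (by linarith)]
  have hT34 : (T : ℝ) ^ (3 / 4 : ℝ) = τ ^ 3 := by
    rw [hT4, ← Real.rpow_natCast, ← Real.rpow_mul (by positivity), ← Real.rpow_natCast]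
    norm_num
  have hX : √(T * ι) = (τ * j) ^ 2 := by
    rw [Real.sqrt_mul (Nat.cast_nonneg T), hτ2, hj2, mul_pow]
  rw [regretRate, hT34]
  rw [hX] at h hBX hL2 ⊢
  set B := C * (σ + R) with hB
  have hB0 : 0 ≤ B := by positivity
  set X := (τ * j) ^ 2 with hXdef
  have hX0 : 0 ≤ X := by positivity
  set P := L + C * σ * X with hPdef
  have hP1 : 1 ≤ P := by
    have : 0 ≤ C * σ * X := by positivity
    linarith
  have hP0 : 0 < √P := Real.sqrt_pos.2 (by linarith)
  have hPP : √P * √P = P := Real.mul_self_sqrt (by linarith)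
  -- Rounding gives `L ≤ B X + 1`, so `P ≤ 1 + 2 B X`; and `(3/2)² ≥ 2`.
  have hPup : √P ≤ 1 + 3 / 2 * √B * (τ * j) := by
    rw [Real.sqrt_le_iff]
    refine ⟨by positivity, ?_⟩
    have h1 : C * σ * X ≤ B * X := by
      refine mul_le_mul_of_nonneg_right ?_ hX0
      exact mul_le_mul_of_nonneg_left (by linarith) hC
    have h2 : (√B * (τ * j)) ^ 2 = B * X := by rw [mul_pow, Real.sq_sqrt hB0]
    have h3 : 0 ≤ √B * (τ * j) := by positivity
    have h4 : 0 ≤ B * X := by positivity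
    nlinarith
  -- The choice of `L` balances the two terms: `B X ≤ 2 L ≤ 2 P`.
  have hsecond : X * C * (σ + R) / √P ≤ 2 * √P := by
    rw [div_le_iff₀ hP0, mul_assoc 2, hPP]
    have : 0 ≤ C * σ * X := by positivity
    have : X * C * (σ + R) = B * X := by rw [hB]; ring
    linarith
  have hsq : √((N : ℝ) * T) ≤ N * τ ^ 3 := by
    rw [Real.sqrt_mul (Nat.cast_nonneg N), hτ2]
    have h1 : √(N : ℝ) ≤ N := by
      rw [Real.sqrt_le_left (by positivity)]
      nlinarith
    have h2 : τ ^ 2 ≤ τ ^ 3 := pow_le_pow_right₀ hτ1 (by norm_num)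
    gcongr
  have hXle : X ≤ ι * τ ^ 3 := by
    rw [hXdef, mul_pow, hι4, mul_comm]
    have h1 : j ^ 2 ≤ j ^ 4 := pow_le_pow_right₀ hj1 (by norm_num)
    have h2 : τ ^ 2 ≤ τ ^ 3 := pow_le_pow_right₀ hτ1 (by norm_num)
    gcongr
  have hX3 : X * (τ * j) ≤ ι * τ ^ 3 := by
    have h1 : X * (τ * j) = j ^ 3 * τ ^ 3 := by rw [hXdef]; ring
    rw [h1, hι4]
    have h2 : j ^ 3 ≤ j ^ 4 := pow_le_pow_right₀ hj1 (by norm_num)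
    gcongr
  have hmain : X * (√P + X * C * (σ + R) / √P) ≤ (3 + 9 / 2 * √B) * (ι * τ ^ 3) := by
    calc X * (√P + X * C * (σ + R) / √P) ≤ X * (3 * (1 + 3 / 2 * √B * (τ * j))) := by
          refine mul_le_mul_of_nonneg_left ?_ hX0
          linarith
      _ = 3 * X + 9 / 2 * √B * (X * (τ * j)) := by ring
      _ ≤ 3 * (ι * τ ^ 3) + 9 / 2 * √B * (ι * τ ^ 3) := by gcongr
      _ = _ := by ring
  have hfirst : R * d * ι * √((N : ℝ) * T) ≤ R * d * ι * (N * τ ^ 3) := by gcongr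
  have hsec : (N : ℝ) * d * X * (√P + X * C * (σ + R) / √P)
      ≤ N * d * ((3 + 9 / 2 * √B) * (ι * τ ^ 3)) := by
    rw [mul_assoc ((N : ℝ) * d)]
    gcongr
  have hZ : 0 ≤ N * d * (ι * τ ^ 3) := by positivity
  have hZB : 0 ≤ √B * (N * d * (ι * τ ^ 3)) := by positivity
  have hZR : 0 ≤ R * (N * d * (ι * τ ^ 3)) := by positivity
  linarith

theorem card_syncSteps_le (T L : ℕ) : ((syncSteps T L).card : ℝ) ≤ T / L + 1 := by
  have h : (syncSteps T L).card ≤ T / L + 1 := by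
    rw [← Finset.card_range (T / L + 1)]
    -- Division by `L` is injective on multiples of `L`.
    refine Finset.card_le_card_of_injOn (fun t => t / L) (fun t ht => ?_) fun s hs t ht hst => ?_
    · have := (Finset.mem_filter.1 ht).1
      exact Finset.mem_coe.2 (Finset.mem_range.2
        (Nat.lt_succ_of_le (Nat.div_le_div_right (Finset.mem_range.1 this).le)))
    · have h1 := Nat.div_mul_cancel (Finset.mem_filter.1 hs).2
      have h2 := Nat.div_mul_cancel (Finset.mem_filter.1 ht).2
      simp only at hst
      rw [← h1, ← h2, hst]
  have h2 : ((T / L : ℕ) : ℝ) ≤ (T : ℝ) / L := Nat.cast_div_le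
  have h3 : ((syncSteps T L).card : ℝ) ≤ ((T / L : ℕ) : ℝ) + 1 := by exact_mod_cast h
  linarith

theorem card_syncSteps_le_sqrt (hT : 0 < T) (hL : 0 < L) (hι : 1 ≤ ι) (hC : 0 < C)
    (hσR : 0 < σ + R) (h : |(L : ℝ) - C * (σ + R) * √(T * ι)| ≤ 1) :
    ((syncSteps T L).card : ℝ) ≤ 2 * (1 + 1 / (C * (σ + R))) * √(T : ℝ) := by
  have hT1 : (1 : ℝ) ≤ T := by exact_mod_cast hT
  have hL0 : (0 : ℝ) < L := by exact_mod_cast hL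
  have hBX := two_mul_length_ge hL h
  set B := C * (σ + R) with hB
  have hB0 : 0 < B := by positivity
  have hs1 : 1 ≤ √(T : ℝ) := Real.one_le_sqrt.2 hT1
  have hTT : √(T : ℝ) * √T = T := Real.mul_self_sqrt (Nat.cast_nonneg T)
  have h1 : √(T : ℝ) ≤ √(T * ι) :=
    Real.sqrt_le_sqrt (le_mul_of_one_le_right (Nat.cast_nonneg T) hι)
  have h2 : (T : ℝ) / L ≤ 2 * (1 / B) * √T := by
    rw [div_le_iff₀ hL0]
    have h3 : B * √T ≤ 2 * L := (mul_le_mul_of_nonneg_left h1 hB0.le).trans hBX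
    calc (T : ℝ) = 1 / B * √T * (B * √T) := by
          field_simp
          rw [sq, hTT]
      _ ≤ 1 / B * √T * (2 * L) := by gcongr
      _ = _ := by ring
  have := card_syncSteps_le T L
  linarith

end Rate

/-! ### Assembly of the theorem -/

theorem Env.reliable_nonempty {Ω : Type*} {d N T : ℕ} {e : Env Ω d N} (hN : 0 < N)
    (hα : e.alpha T < 1 / 2) {t : ℕ} (ht : t < T) : (e.reliable t).Nonempty := by
  have hN' : (0 : ℝ) < N := by exact_mod_cast hN
  have h1 : (e.corrupted T).card < Fintype.card (Fin N) := by
    rw [Env.alpha, div_lt_iff₀ hN'] at hα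
    rw [Fintype.card_fin]
    have : ((e.corrupted T).card : ℝ) < N := by linarith
    exact_mod_cast this
  obtain ⟨i, hi⟩ := (Finset.card_compl_lt_iff_nonempty _).1
    (show ((e.corrupted T)ᶜ)ᶜ.card < _ by rwa [compl_compl])
  exact ⟨i, mem_reliable_of_notMem_corrupted ht hi⟩

/-- Only subadditivity is used, so neither event has to be measurable. -/
theorem ofReal_one_sub_le_of_measure_compl_le {Ω : Type*} [MeasurableSpace Ω] {μ : Measure Ω}
    [IsProbabilityMeasure μ] {P Q : Ω → Prop} {δ : ℝ} (hδ : 0 ≤ δ) (h : ∀ ω, P ω → Q ω)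
    (hP : μ {ω | ¬ P ω} ≤ ENNReal.ofReal δ) : ENNReal.ofReal (1 - δ) ≤ μ {ω | Q ω} := by
  rw [ENNReal.ofReal_sub _ hδ, ENNReal.ofReal_one, tsub_le_iff_right]
  calc (1 : ENNReal) = μ Set.univ := measure_univ.symm
    _ ≤ μ ({ω | Q ω} ∪ {ω | ¬ P ω}) := measure_mono fun ω _ => by
        by_cases hω : P ω
        · exact Or.inl (h ω hω)
        · exact Or.inr hω
    _ ≤ _ := (measure_union_le _ _).trans (add_le_add le_rfl hP)

end ByzantineUCB

open ByzantineUCB in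
theorem theorem1 :
    ∃ c : ℝ, 0 < c ∧
      ∀ (Ω : Type*) [mΩ : MeasurableSpace Ω] (μ : Measure Ω) [IsProbabilityMeasure μ]
        (ℱ : Filtration ℕ mΩ)
        (d N T L : ℕ) (R σ δ : ℝ) (e : Env Ω d N) (r : Run Ω d N)
        (pick : ℕ → Vec d → Mat d → DecisionSet d → Vec d),
        0 < d → 0 < N → 0 < T → 0 < L → 0 ≤ R → 0 ≤ σ → 0 < δ → δ < 1 →
        e.Valid μ ℱ T R →
        e.alpha T < 1 / 2 →
        IsArgmaxRule (fun t => conf d N L (iota N T δ) (e.Calpha T) σ R (t / L)) pick →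
        r.IsExecution e ℱ T L (reg L (iota N T δ) (e.Calpha T) σ) pick →
        r.VarianceBound e μ ℱ T σ →
        ENNReal.ofReal (1 - δ) ≤
            μ {ω | r.regret e T ω ≤ c * regretRate d N T L (iota N T δ) (e.Calpha T) σ R} ∧
        (|(L : ℝ) - e.Calpha T * (σ + R) * √(T * iota N T δ)| ≤ 1 →
          ENNReal.ofReal (1 - δ) ≤
            μ {ω | r.regret e T ω ≤
              c * (1 + R + √(e.Calpha T * (σ + R))) * iota N T δ *
                (d * N * (T : ℝ) ^ (3 / 4 : ℝ))} ∧
          (0 < σ + R →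
            ((syncSteps T L).card : ℝ) ≤ c * (1 + 1 / (e.Calpha T * (σ + R))) * √(T : ℝ))) := by
  -- `330 = 66 · 5`, the constants of the regret bound and of `regretRate_le`; the round count needs
  -- only `2`.
  refine ⟨330, by norm_num, ?_⟩
  intro Ω mΩ μ _ ℱ d N T L R σ δ e r pick hd hN hT hL hR hσ hδ hδ1 he hα hp hr hv
  have hι := one_le_iota hN hT hδ hδ1
  have hι0 : 0 ≤ iota N T δ := zero_le_one.trans hι
  have hC1 := e.one_le_Calpha hα
  have hC0 : 0 ≤ e.Calpha T := zero_le_one.trans hC1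
  have hlog := log_one_add_div_le_iota (N := N) (L := L) hN hT hL hδ hδ1
  have hbad := (hr.measure_not_concentrated_le he hp hv hσ (zero_lt_one.trans_le hι) hL
    fun t ht => Env.reliable_nonempty hN hα ht).trans
      (ENNReal.ofReal_le_ofReal (exp_neg_iota hN hT hδ))
  have hreg : ∀ ω, Concentrated r e
      (condMeanOuter e r (reg L (iota N T δ) (e.Calpha T) σ) pick L) T L (iota N T δ) σ R ω →
      r.regret e T ω ≤ 66 * regretRate d N T L (iota N T δ) (e.Calpha T) σ R := by
    intro ω hω
    rcases le_total L T with hLT | hTL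
    · exact (hr.regret_le he hp hd hN hL hι0 hR hσ hα hlog hω (by positivity)
        fun k hk => conf_le hL hLT hk hι0 hC0 hσ hR).trans
          (bound_le_regretRate hN hι0 hC0 hσ hR)
    · exact (hr.regret_le_trivial he hp ω).trans
        (trivial_bound_le_regretRate hd hTL hι hC0 hσ hR)
  have hrate : 0 ≤ regretRate d N T L (iota N T δ) (e.Calpha T) σ R := by
    rw [regretRate]
    positivity
  refine ⟨ofReal_one_sub_le_of_measure_compl_le hδ.le (fun ω hω => ?_) hbad, fun hL' =>
    ⟨ofReal_one_sub_le_of_measure_compl_le hδ.le (fun ω hω => ?_) hbad, fun hσR => ?_⟩⟩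
  · exact (hreg ω hω).trans (by linarith)
  · have := regretRate_le (d := d) hN hT hL hι hC0 hσ hR hL'
    exact (hreg ω hω).trans (by linarith)
  · refine (card_syncSteps_le_sqrt hT hL hι (zero_lt_one.trans_le hC1) hσR hL').trans ?_
    have : 0 ≤ (1 + 1 / (e.Calpha T * (σ + R))) * √(T : ℝ) := by positivity
    linarith
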